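/- **Theorem.** Let $n, k, r$ be integers with $n \ge 1$, $0 \le k \le n$ and $r \ge 2$. Let $\mathbb{C}[\mathbf{x}_n] = \mathbb{C}[x_1,\dots,x_n]$, ordered by the lexicographic monomial order with $x_1 > x_2 > \cdots > x_n$. Let $e_d(\mathbf{x}_n^r) = e_d(x_1^r,\dots,x_n^r)$ be the elementary symmetric polynomials in $x_1^r,\dots,x_n^r$, and let $$I_{n,k} = \langle x_1^{kr+1},\dots,x_n^{kr+1},\, e_n(\mathbf{x}_n^r), e_{n-1}(\mathbf{x}_n^r), \dots, e_{n-k+1}(\mathbf{x}_n^r)\rangle,$$ $$J_{n,k} = \langle x_1^{kr},\dots,x_n^{kr},\, e_n(\mathbf{x}_n^r), e_{n-1}(\mathbf{x}_n^r), \dots, e_{n-k+1}(\mathbf{x}_n^r)\rangle.$$ For a sequence $\gamma = (\gamma_1,\dots,\gamma_n)$ of nonnegative integers the *Demazure character* $\kappa_\gamma(\mathbf{x}_n)$ is the polynomial determined by the following recursion: $\kappa_\gamma = x_1^{\gamma_1}\cdots x_n^{\gamma_n}$ if $\gamma_1 \ge \cdots \ge \gamma_n$, and $$\kappa_\gamma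 = \frac{x_i\,\kappa_{\gamma'} - x_{i+1}\,(s_i\cdot\kappa_{\gamma'})}{x_i - x_{i+1}}$$ if $\gamma_i < \gamma_{i+1}$, where $\gamma'$ is $\gamma$ with its $i$-th and $(i+1)$-st parts interchanged and $s_i$ interchanges the variables $x_i$ and $x_{i+1}$. For $S = \{s_1 < \cdots < s_m\} \subseteq [n] = \{1,\dots,n\}$ the *skip composition* $\gamma(S) = (\gamma_1,\dots,\gamma_n)$ has $\gamma_i = s_j - j + 1$ if $i = s_j \in S$ and $\gamma_i = 0$ if $i \notin S$; let $\overline{\gamma(S)} = (\gamma_n,\dots,\gamma_1)$. For $f \in \mathbb{C}[\mathbf{x}_n]$ write $\overline{f(\mathbf{x}_n^r)} = f(x_n^r,\dots,x_1^r)$. 1. The variable powers $x_1^{kr+1},\dots,x_n^{kr+1}$ together with the polynomials $\overline{\kappa_{\overline{\gamma(S)}}(\mathbf{x}_n^r)}$ for $S \subseteq [n]$ with $|S| = n-k+1$ form a Gröbner basis of $I_{n,k}$. If $n > k > 0$, this Gröbner basis is reduced. 2. The variable powers $x_1^{kr},\dots,x_n^{kr}$ together with the polynomials $\overline{\kappa_{\overline{\gamma(S)}}(\mathbf{x}_n^r)}$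 for $S \subseteq [n-1]$ with $|S| = n-k+1$ form a Gröbner basis of $J_{n,k}$. If $n > k > 0$, this Gröbner basis is reduced. Here a Gröbner basis of an ideal $I$ is a finite set of nonzero elements of $I$ whose leading terms generate the ideal generated by the leading terms of all nonzero elements of $I$. It is reduced if all its leading coefficients are $1$ and the leading monomial of one element never divides a monomial appearing in a different element. -/

import Mathlib

noncomputable section

namespace SkipGroebner

open MvPolynomial

/-! ### Initial ideals and Gröbner bases -/

section Groebner

/-- The initial ideal: generated by the leading terms of the nonzero elements of `I`. -/
def initialIdeal {σ R : Type*} [CommRing R] (m : MonomialOrder σ)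
    (I : Ideal (MvPolynomial σ R)) : Ideal (MvPolynomial σ R) :=
  Ideal.span {t | ∃ f ∈ I, f ≠ 0 ∧ t = m.leadingTerm f}

/-- A finite set `B` of nonzero elements of `I` is a Gröbner basis of `I` if the leading terms of
its elements generate the initial ideal of `I`. -/
def IsGroebnerBasis {σ R : Type*} [CommRing R] (m : MonomialOrder σ)
    (B : Set (MvPolynomial σ R)) (I : Ideal (MvPolynomial σ R)) : Prop :=
  B.Finite ∧ (∀ g ∈ B, g ∈ I ∧ g ≠ 0) ∧
    initialIdeal m I = Ideal.span {t | ∃ g ∈ B, t = m.leadingTerm g}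

/-- A Gröbner basis is reduced if all leading coefficients are `1` and the leading monomial of an
element divides no monomial appearing in another element. (The monomial with exponent `c` divides
the monomial with exponent `d` exactly when `c ≤ d` componentwise.) -/
def IsReducedGroebnerBasis {σ R : Type*} [CommRing R] (m : MonomialOrder σ)
    (B : Set (MvPolynomial σ R)) (I : Ideal (MvPolynomial σ R)) : Prop :=
  IsGroebnerBasis m B I ∧ (∀ g ∈ B, m.leadingCoeff g = 1) ∧
    ∀ g ∈ B, ∀ h ∈ B, g ≠ h → ∀ d ∈ h.support, ¬ m.degree g ≤ d

end Groebner

/-! ### Demazure characters -/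

section Demazure

variable {n : ℕ}

/-- `s f`, the polynomial `f` with the variables `x_i` and `x_j` interchanged. -/
abbrev swapVars (i j : Fin n) : MvPolynomial (Fin n) ℂ →ₐ[ℂ] MvPolynomial (Fin n) ℂ :=
  rename (Equiv.swap i j)

theorem X_sub_X_dvd (i j : Fin n) (f : MvPolynomial (Fin n) ℂ) :
    (X i - X j : MvPolynomial (Fin n) ℂ) ∣ X i * f - X j * swapVars i j f := by
  have key : (X i - X j : MvPolynomial (Fin n) ℂ) ∣ f - swapVars i j f := by
    rw [← Ideal.mem_span_singleton, ← Ideal.Quotient.mk_eq_mk_iff_sub_mem]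
    set I : Ideal (MvPolynomial (Fin n) ℂ) := Ideal.span {X i - X j}
    have hij : Ideal.Quotient.mkₐ ℂ I (X i) = Ideal.Quotient.mkₐ ℂ I (X j) :=
      (Ideal.Quotient.mk_eq_mk_iff_sub_mem _ _).2 (Ideal.mem_span_singleton_self _)
    have h : Ideal.Quotient.mkₐ ℂ I = (Ideal.Quotient.mkₐ ℂ I).comp (swapVars i j) := by
      apply MvPolynomial.algHom_ext
      intro a
      simp only [AlgHom.comp_apply, rename_X]
      by_cases h1 : a = i
      · subst h1; rw [Equiv.swap_apply_left, hij]
      by_cases h2 : a = j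
      · subst h2; rw [Equiv.swap_apply_right, hij]
      rw [Equiv.swap_apply_of_ne_of_ne h1 h2]
    exact congrArg (fun φ => φ f) h
  have e : X i * f - X j * swapVars i j f
      = (X i - X j) * f + X j * (f - swapVars i j f) := by ring
  rw [e]
  exact dvd_add (dvd_mul_right _ _) (key.mul_left _)

/-- The quotient `(x_i f - x_j (s f)) / (x_i - x_j)`, a polynomial; it is determined by
`demazureOp_spec` when `i ≠ j`. -/
def demazureOp (i j : Fin n) (f : MvPolynomial (Fin n) ℂ) : MvPolynomial (Fin n) ℂ :=
  (X_sub_X_dvd i j f).choose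

theorem demazureOp_spec (i j : Fin n) (f : MvPolynomial (Fin n) ℂ) :
    (X i - X j) * demazureOp i j f = X i * f - X j * swapVars i j f :=
  (X_sub_X_dvd i j f).choose_spec.symm

/-- `i` and `j` are consecutive positions at which the composition `γ` increases. -/
def IsAscent (γ : Fin n → ℕ) (i j : Fin n) : Prop :=
  (i : ℕ) + 1 = j ∧ γ i < γ j

/-- Interchange the parts in positions `i` and `j`. -/
def swapParts (γ : Fin n → ℕ) (i j : Fin n) : Fin n → ℕ :=
  γ ∘ Equiv.swap i j

/-- The termination measure for the recursion below. -/
def weight (γ : Fin n → ℕ) : ℕ := ∑ a : Fin n, (a : ℕ) * γ a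

theorem weight_swapParts_lt (γ : Fin n → ℕ) (i j : Fin n) (h : IsAscent γ i j) :
    weight (swapParts γ i j) < weight γ := by
  obtain ⟨h1, h2⟩ := h
  have hne : i ≠ j := by rintro rfl; omega
  have hj : j ∈ Finset.univ.erase i := by simp [hne.symm]
  unfold weight
  rw [← Finset.add_sum_erase _ _ (Finset.mem_univ i), ← Finset.add_sum_erase _ _ hj,
    ← Finset.add_sum_erase _ (fun a : Fin n => (a : ℕ) * γ a) (Finset.mem_univ i),
    ← Finset.add_sum_erase _ (fun a : Fin n => (a : ℕ) * γ a) hj]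
  have e : ∑ a ∈ (Finset.univ.erase i).erase j, (a : ℕ) * swapParts γ i j a
      = ∑ a ∈ (Finset.univ.erase i).erase j, (a : ℕ) * γ a := by
    apply Finset.sum_congr rfl
    intro a ha
    simp only [Finset.mem_erase, Finset.mem_univ, and_true] at ha
    simp [swapParts, Equiv.swap_apply_of_ne_of_ne ha.2 ha.1]
  rw [e]
  simp only [swapParts, Function.comp, Equiv.swap_apply_left, Equiv.swap_apply_right, ← h1]
  nlinarith

open scoped Classical in
/-- The Demazure character `κ_γ`. If `γ` has an ascent, one is chosen and the recursion
is applied there; otherwise `γ` is weakly decreasing and `κ_γ = x^γ`. The choice is immaterial: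
see `demazureChar_of_isAscent` below. -/
def demazureChar (γ : Fin n → ℕ) : MvPolynomial (Fin n) ℂ :=
  if h : ∃ p : Fin n × Fin n, IsAscent γ p.1 p.2 then
    demazureOp h.choose.1 h.choose.2
      (demazureChar (swapParts γ h.choose.1 h.choose.2))
  else ∏ i, X i ^ γ i
termination_by weight γ
decreasing_by exact weight_swapParts_lt _ _ _ h.choose_spec

/-- If `γ` is weakly decreasing then `κ_γ = x^γ`. -/
theorem demazureChar_of_antitone (γ : Fin n → ℕ) (h : Antitone γ) :
    demazureChar γ = ∏ i, X i ^ γ i := by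
  rw [demazureChar.eq_def, dif_neg]
  rintro ⟨p, hp, hlt⟩
  have : p.1 ≤ p.2 := by rw [Fin.le_def]; omega
  exact absurd (h this) (by omega)

theorem X_sub_X_ne_zero {i j : Fin n} (h : i ≠ j) :
    (X i - X j : MvPolynomial (Fin n) ℂ) ≠ 0 :=
  sub_ne_zero.2 fun e => h (X_injective e)

theorem swapVars_spec (a b i j : Fin n) (f : MvPolynomial (Fin n) ℂ) :
    (X (Equiv.swap a b i) - X (Equiv.swap a b j)) * swapVars a b (demazureOp i j f)
      = X (Equiv.swap a b i) * swapVars a b f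
        - X (Equiv.swap a b j) * swapVars a b (swapVars i j f) := by
  have := congrArg (swapVars a b) (demazureOp_spec i j f)
  simpa [map_mul, map_sub, rename_X] using this

theorem demazureOp_comm {i j k l : Fin n} (hij : i ≠ j) (hkl : k ≠ l) (hik : i ≠ k) (hil : i ≠ l)
    (hjk : j ≠ k) (hjl : j ≠ l) (f : MvPolynomial (Fin n) ℂ) :
    demazureOp i j (demazureOp k l f) = demazureOp k l (demazureOp i j f) := by
  apply mul_left_cancel₀ (mul_ne_zero (X_sub_X_ne_zero hij) (X_sub_X_ne_zero hkl))
  have hc : swapVars i j (swapVars k l f) = swapVars k l (swapVars i j f) := by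
    simp only [swapVars, rename_rename]
    congr 2
    funext a
    have : (Equiv.swap i j) * (Equiv.swap k l) = (Equiv.swap k l) * (Equiv.swap i j) := by
      apply Equiv.Perm.Disjoint.commute
      intro a
      by_cases h1 : a = i
      · right; subst h1; exact Equiv.swap_apply_of_ne_of_ne hik hil
      by_cases h2 : a = j
      · right; subst h2; exact Equiv.swap_apply_of_ne_of_ne hjk hjl
      left; exact Equiv.swap_apply_of_ne_of_ne h1 h2
    exact congrArg (fun σ : Equiv.Perm (Fin n) => σ a) this
  have a1 := demazureOp_spec i j (demazureOp k l f)
  have a2 := demazureOp_spec k l f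
  have a3 := swapVars_spec i j k l f
  have b1 := demazureOp_spec k l (demazureOp i j f)
  have b2 := demazureOp_spec i j f
  have b3 := swapVars_spec k l i j f
  rw [Equiv.swap_apply_of_ne_of_ne hik.symm hjk.symm,
    Equiv.swap_apply_of_ne_of_ne hil.symm hjl.symm] at a3
  rw [Equiv.swap_apply_of_ne_of_ne hik hil, Equiv.swap_apply_of_ne_of_ne hjk hjl] at b3
  rw [hc] at a3
  linear_combination (X k - X l) * a1 + X i * a2 - X j * a3
    - (X i - X j) * b1 - X k * b2 + X l * b3

theorem demazureOp_braid {i j k : Fin n} (hij : i ≠ j) (hjk : j ≠ k) (hik : i ≠ k)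
    (f : MvPolynomial (Fin n) ℂ) :
    demazureOp i j (demazureOp j k (demazureOp i j f))
      = demazureOp j k (demazureOp i j (demazureOp j k f)) := by
  have hb : swapVars i j (swapVars j k (swapVars i j f))
      = swapVars j k (swapVars i j (swapVars j k f)) := by
    simp only [swapVars, rename_rename]
    congr 2
    funext a
    simp only [Function.comp]
    have h1 := Equiv.swap_mul_swap_mul_swap hij hik
    grind
  have inv : ∀ (a b : Fin n), a ≠ b → ∀ g : MvPolynomial (Fin n) ℂ,
      swapVars a b (demazureOp a b g) = demazureOp a b g := by
    intro a b hab g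
    apply mul_left_cancel₀ (X_sub_X_ne_zero hab)
    have h1 := swapVars_spec a b a b g
    have h2 := demazureOp_spec a b g
    have h3 : swapVars a b (swapVars a b g) = g := by
      have : (Equiv.swap a b : Fin n → Fin n) ∘ Equiv.swap a b = id := by
        funext c; simp
      rw [swapVars, rename_rename, this, rename_id_apply]
    rw [Equiv.swap_apply_left, Equiv.swap_apply_right, h3] at h1
    linear_combination -h1 - h2
  apply mul_left_cancel₀ (mul_ne_zero (mul_ne_zero (X_sub_X_ne_zero hij) (X_sub_X_ne_zero hjk))
    (X_sub_X_ne_zero hik))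
  have sik : Equiv.swap i j k = k := Equiv.swap_apply_of_ne_of_ne hik.symm hjk.symm
  have ski : Equiv.swap j k i = i := Equiv.swap_apply_of_ne_of_ne hij hik
  have si : Equiv.swap i j i = j := Equiv.swap_apply_left _ _
  have sj : Equiv.swap i j j = i := Equiv.swap_apply_right _ _
  have tj : Equiv.swap j k j = k := Equiv.swap_apply_left _ _
  have tk : Equiv.swap j k k = j := Equiv.swap_apply_right _ _
  -- the left side
  have p1 := demazureOp_spec i j (demazureOp j k (demazureOp i j f))
  have p2 := demazureOp_spec j k (demazureOp i j f)
  have p3 := swapVars_spec i j j k (demazureOp i j f)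
  have p4 := demazureOp_spec i j f
  have p5 := swapVars_spec j k i j f
  have p6 := congrArg (swapVars i j) p5
  -- the right side
  have q1 := demazureOp_spec j k (demazureOp i j (demazureOp j k f))
  have q2 := demazureOp_spec i j (demazureOp j k f)
  have q3 := swapVars_spec j k i j (demazureOp j k f)
  have q4 := demazureOp_spec j k f
  have q5 := swapVars_spec i j j k f
  have q6 := congrArg (swapVars j k) q5
  rw [inv i j hij] at p3
  rw [inv j k hjk] at q3
  simp only [map_mul, map_sub, rename_X, sik, ski, si, sj, tj, tk] at p3 p5 p6 q3 q5 q6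
  rw [hb] at p6
  linear_combination (X j - X k) * (X i - X k) * p1 + X i * (X i - X k) * p2
    - X j * (X j - X k) * p3 + X i * X j * p4 - X i * X k * p5 + X j * X k * p6
    - ((X i - X j) * (X i - X k) * q1 + X j * (X i - X k) * q2 - X k * (X i - X j) * q3
      + X i ^ 2 * q4 - X j ^ 2 * q5 + X k ^ 2 * q6)

/-- The recursion for Demazure characters: it holds at every ascent of `γ`. -/
theorem demazureChar_of_isAscent (γ : Fin n → ℕ) (i j : Fin n) (h : IsAscent γ i j) :
    demazureChar γ = demazureOp i j (demazureChar (swapParts γ i j)) := by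
  induction hN : weight γ using Nat.strong_induction_on generalizing γ i j with
  | _ N ih =>
  subst hN
  replace ih : ∀ δ : Fin n → ℕ, weight δ < weight γ → ∀ i j, IsAscent δ i j →
      demazureChar δ = demazureOp i j (demazureChar (swapParts δ i j)) :=
    fun δ hδ i j hij => ih _ hδ δ i j hij rfl
  -- three consecutive increasing parts
  have chain : ∀ a b c : Fin n, IsAscent γ a b → IsAscent γ b c →
      demazureOp a b (demazureChar (swapParts γ a b))
        = demazureOp b c (demazureChar (swapParts γ b c)) := by
    intro a b c hab hbc
    have w1 := weight_swapParts_lt γ a b hab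
    have w2 := weight_swapParts_lt γ b c hbc
    obtain ⟨e1, l1⟩ := hab
    obtain ⟨e2, l2⟩ := hbc
    have nab : a ≠ b := by rintro rfl; omega
    have nbc : b ≠ c := by rintro rfl; omega
    have nac : a ≠ c := by rintro rfl; omega
    have u1 : IsAscent (swapParts γ a b) b c := by
      refine ⟨e2, ?_⟩
      simp only [swapParts, Function.comp, Equiv.swap_apply_right,
        Equiv.swap_apply_of_ne_of_ne nac.symm nbc.symm]
      omega
    have w3 := weight_swapParts_lt _ _ _ u1
    have u2 : IsAscent (swapParts (swapParts γ a b) b c) a b := by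
      refine ⟨e1, ?_⟩
      simp only [swapParts, Function.comp, Equiv.swap_apply_left,
        Equiv.swap_apply_of_ne_of_ne nac.symm nbc.symm, Equiv.swap_apply_of_ne_of_ne nab nac]
      omega
    have u3 : IsAscent (swapParts γ b c) a b := by
      refine ⟨e1, ?_⟩
      simp only [swapParts, Function.comp, Equiv.swap_apply_left,
        Equiv.swap_apply_of_ne_of_ne nab nac]
      omega
    have w4 := weight_swapParts_lt _ _ _ u3
    have u4 : IsAscent (swapParts (swapParts γ b c) a b) b c := by
      refine ⟨e2, ?_⟩
      simp only [swapParts, Function.comp, Equiv.swap_apply_right,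
        Equiv.swap_apply_of_ne_of_ne nac.symm nbc.symm, Equiv.swap_apply_of_ne_of_ne nab nac]
      omega
    rw [ih _ w1 _ _ u1, ih _ (w3.trans w1) _ _ u2, ih _ w2 _ _ u3, ih _ (w4.trans w2) _ _ u4,
      demazureOp_braid nab nbc nac]
    congr 4
    funext d
    simp only [swapParts, Function.comp]
    congr 1
    grind
  have hex : ∃ p : Fin n × Fin n, IsAscent γ p.1 p.2 := ⟨(i, j), h⟩
  obtain ⟨a, b, hab, hγ⟩ : ∃ a b, IsAscent γ a b ∧
      demazureChar γ = demazureOp a b (demazureChar (swapParts γ a b)) := by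
    refine ⟨hex.choose.1, hex.choose.2, hex.choose_spec, ?_⟩
    conv_lhs => rw [demazureChar.eq_def, dif_pos hex]
  rw [hγ]
  by_cases hai : a = i
  · have : b = j := by
      subst hai; apply Fin.ext; have := hab.1; have := h.1; omega
    rw [hai, this]
  by_cases hbi : b = i
  · subst hbi; exact chain _ _ _ hab h
  by_cases hja : j = a
  · subst hja; exact (chain _ _ _ h hab).symm
  have hjb : j ≠ b := by
    rintro rfl; apply hai; apply Fin.ext; have := hab.1; have := h.1; omega
  have nab : a ≠ b := by rintro rfl; have := hab.1; omega
  have nij : i ≠ j := by rintro rfl; have := h.1; omega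
  have u1 : IsAscent (swapParts γ a b) i j := by
    refine ⟨h.1, ?_⟩
    simp only [swapParts, Function.comp, Equiv.swap_apply_of_ne_of_ne (Ne.symm hai) (Ne.symm hbi),
      Equiv.swap_apply_of_ne_of_ne hja hjb]
    exact h.2
  have u2 : IsAscent (swapParts γ i j) a b := by
    refine ⟨hab.1, ?_⟩
    simp only [swapParts, Function.comp, Equiv.swap_apply_of_ne_of_ne hai (Ne.symm hja),
      Equiv.swap_apply_of_ne_of_ne hbi hjb.symm]
    exact hab.2
  rw [ih _ (weight_swapParts_lt _ _ _ hab) _ _ u1, ih _ (weight_swapParts_lt _ _ _ h) _ _ u2,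
    demazureOp_comm nab nij hai (Ne.symm hja) hbi hjb.symm]
  congr 3
  funext d
  simp only [swapParts, Function.comp]
  congr 1
  grind

end Demazure

/-! ### Skip compositions, the ideals, and the bases -/

/-- The skip composition `γ(S)` of `S ⊆ [n]`: if `i = s_j` is the `j`-th smallest element of `S`,
its `i`-th part is `s_j - j + 1`, and it is `0` if `i ∉ S`. The element `i : Fin n` stands for
`i + 1 ∈ [n]`, and `j - 1` is the number of elements of `S` smaller than it. -/
def skipComposition {n : ℕ} (S : Finset (Fin n)) (i : Fin n) : ℕ :=
  if i ∈ S then (i : ℕ) + 1 - (S.filter (· < i)).card else 0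

/-- The polynomial `f(x_n^r, …, x_1^r)`. -/
def reversePow {n : ℕ} (r : ℕ) (f : MvPolynomial (Fin n) ℂ) : MvPolynomial (Fin n) ℂ :=
  aeval (fun i => (X i.rev : MvPolynomial (Fin n) ℂ) ^ r) f

/-- The reversed Demazure character in `x^r` attached to the reverse of `γ(S)`. -/
def skipDemazure {n : ℕ} (r : ℕ) (S : Finset (Fin n)) : MvPolynomial (Fin n) ℂ :=
  reversePow r (demazureChar (fun i => skipComposition S i.rev))

/-- `e_d(x_1^r, …, x_n^r)`. -/
def esymmPow (n r d : ℕ) : MvPolynomial (Fin n) ℂ :=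
  aeval (fun i => (X i : MvPolynomial (Fin n) ℂ) ^ r) (esymm (Fin n) ℂ d)

/-- The ideal `I_{n,k}`. -/
def idealI (n k r : ℕ) : Ideal (MvPolynomial (Fin n) ℂ) :=
  Ideal.span ({f | ∃ i, f = X i ^ (k * r + 1)} ∪
    {f | ∃ d, n - k + 1 ≤ d ∧ d ≤ n ∧ f = esymmPow n r d})

/-- The ideal `J_{n,k}`. -/
def idealJ (n k r : ℕ) : Ideal (MvPolynomial (Fin n) ℂ) :=
  Ideal.span ({f | ∃ i, f = X i ^ (k * r)} ∪
    {f | ∃ d, n - k + 1 ≤ d ∧ d ≤ n ∧ f = esymmPow n r d})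

/-- The proposed Gröbner basis of `I_{n,k}`; here `S ⊆ [n]`. -/
def basisI (n k r : ℕ) : Set (MvPolynomial (Fin n) ℂ) :=
  {f | ∃ i, f = X i ^ (k * r + 1)} ∪
    {f | ∃ S : Finset (Fin n), S.card = n - k + 1 ∧ f = skipDemazure r S}

/-- The proposed Gröbner basis of `J_{n,k}`; here `S ⊆ [n-1]`. -/
def basisJ (n k r : ℕ) : Set (MvPolynomial (Fin n) ℂ) :=
  {f | ∃ i, f = X i ^ (k * r)} ∪
    {f | ∃ S : Finset (Fin n), (∀ i ∈ S, (i : ℕ) + 1 ≤ n - 1) ∧ S.card = n - k + 1 ∧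
      f = skipDemazure r S}

end SkipGroebner

end

noncomputable section

namespace SkipGroebner

open MvPolynomial

/-! ### Supports of Demazure characters -/

section Support

variable {n : ℕ}

/-! Both ideals are generated by the powers `x_i^a`, `a = kr + e` (`e = 1` for I, `e = 0` for J),
and the top `k` elementary symmetric polynomials in the `x_i^r`, so they are treated together. Two
things are needed: the proposed elements lie in the ideal, with leading exponent `r γ(S)` and
coefficient 1; and their leading monomials divide every leading monomial of the ideal.

Membership. The reversed skip composition has weakly decreasing nonzero parts, so its Demazure
character is a flagged Jacobi–Trudi determinant (`demazureChar_placeParts`). Modulo the elementary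
symmetric polynomials of degree at least `|S|`, the matrix kills a vector with an entry 1, so the
determinant is 0 there (`det_jacobiTrudi_mem`). The leading term follows from bounds on partial sums
of exponents (`sum_le_of_mem_support_demazureChar`); the bound on single exponents is needed for
reducedness.

Divisibility, by orbit harmonics. Choose `k` nonzero numbers `A`, and let `V` be their `r`-th roots,
together with 0 if `e = 1`. Let `Y` be the set of points of `V^n` whose `r`-th powers cover `A`.
Every generator of the ideal is the top-degree form of a polynomial vanishing on `Y`. Call an
exponent good if its entries are below `a` and it passes the test `IsStandard`. A combination of
good monomials vanishing on `Y` is 0 (`eq_zero_of_eval_eq_zero`), while an exponent that is not good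
is divisible by a proposed leading monomial (`exists_finset_of_not_isStandard`). Reducing modulo the
polynomials vanishing on `Y` then shows that no leading exponent of the ideal is good
(`not_standard_lex_degree`), so each is divisible by a proposed one. -/

theorem demazureOp_eq_of_spec {i j : Fin n} (h : i ≠ j) {f g : MvPolynomial (Fin n) ℂ}
    (hg : (X i - X j) * g = X i * f - X j * swapVars i j f) : demazureOp i j f = g :=
  mul_left_cancel₀ (X_sub_X_ne_zero h) ((demazureOp_spec i j f).trans hg.symm)

/-- Factors symmetric in the two variables pass through the operator; this later lets it act on a
single row of a determinant. -/
theorem demazureOp_sum {i j : Fin n} (h : i ≠ j) {ι : Type*} (s : Finset ι)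
    (c f : ι → MvPolynomial (Fin n) ℂ) (hc : ∀ a ∈ s, swapVars i j (c a) = c a) :
    demazureOp i j (∑ a ∈ s, c a * f a) = ∑ a ∈ s, c a * demazureOp i j (f a) := by
  apply demazureOp_eq_of_spec h
  simp only [Finset.mul_sum, map_sum, map_mul, ← Finset.sum_sub_distrib]
  refine Finset.sum_congr rfl fun a ha => ?_
  rw [hc a ha]
  linear_combination c a * demazureOp_spec i j (f a)

/-- The exponent `a` with its entries at `i` and `j` replaced by `p` and `q`. -/
def replaceTwo (a : Fin n →₀ ℕ) (i j : Fin n) (p q : ℕ) : Fin n →₀ ℕ :=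
  (a.erase i).erase j + Finsupp.single i p + Finsupp.single j q

theorem replaceTwo_apply (a : Fin n →₀ ℕ) {i j : Fin n} (h : i ≠ j) (p q : ℕ) (l : Fin n) :
    replaceTwo a i j p q l = if l = i then p else if l = j then q else a l := by
  unfold replaceTwo
  simp only [Finsupp.add_apply, Finsupp.erase_apply, Finsupp.single_apply]
  split_ifs <;> grind

theorem monomial_replaceTwo (a : Fin n →₀ ℕ) (i j : Fin n) (p q : ℕ) :
    monomial (replaceTwo a i j p q) (1 : ℂ)
      = monomial ((a.erase i).erase j) 1 * X i ^ p * X j ^ q := by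
  simp [replaceTwo, X_pow_eq_monomial, monomial_mul]

theorem replaceTwo_self (a : Fin n →₀ ℕ) {i j : Fin n} (h : i ≠ j) :
    replaceTwo a i j (a i) (a j) = a := by
  ext l
  rw [replaceTwo_apply _ h]
  split_ifs <;> simp_all

theorem swapVars_monomial (a : Fin n →₀ ℕ) {i j : Fin n} (h : i ≠ j) :
    swapVars i j (monomial a 1) = monomial (replaceTwo a i j (a j) (a i)) 1 := by
  rw [rename_monomial]
  refine congrArg (fun b => monomial b 1) (Finsupp.ext fun l => ?_)
  rw [replaceTwo_apply _ h, Finsupp.mapDomain_equiv_apply, Equiv.symm_swap]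
  split_ifs with h1 h2
  · rw [h1, Equiv.swap_apply_left]
  · rw [h2, Equiv.swap_apply_right]
  · rw [Equiv.swap_apply_of_ne_of_ne h1 h2]

/-- The division is a finite geometric sum: the result is the full string of monomials between `x^a`
and its swap. In the opposite order of exponents, treated next, the sign is negative and both ends
of the string are missing. -/
theorem demazureOp_monomial_of_le (a : Fin n →₀ ℕ) {i j : Fin n} (h : i ≠ j) (hle : a j ≤ a i) :
    demazureOp i j (monomial a 1) = ∑ s ∈ Finset.range (a i - a j + 1),
      monomial (replaceTwo a i j (a j + s) (a i - s)) 1 := by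
  apply demazureOp_eq_of_spec h
  obtain ⟨N, hN⟩ := Nat.exists_eq_add_of_le hle
  rw [swapVars_monomial a h]
  have ha := monomial_replaceTwo a i j (a i) (a j)
  rw [replaceTwo_self a h] at ha
  have e : ∑ s ∈ Finset.range (a i - a j + 1),
      monomial (replaceTwo a i j (a j + s) (a i - s)) (1 : ℂ)
      = monomial ((a.erase i).erase j) 1 * (X i * X j) ^ a j
        * ∑ s ∈ Finset.range (N + 1), X i ^ s * X j ^ (N + 1 - 1 - s) := by
    rw [Finset.mul_sum, hN, Nat.add_sub_cancel_left]
    refine Finset.sum_congr rfl fun s hs => ?_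
    rw [Finset.mem_range] at hs
    rw [monomial_replaceTwo, Nat.add_sub_cancel, Nat.add_sub_assoc (by omega)]
    ring
  rw [e]
  have g := (Commute.all (X i : MvPolynomial (Fin n) ℂ) (X j)).mul_geom_sum₂ (N + 1)
  simp only [ha, monomial_replaceTwo, hN]
  linear_combination (monomial ((a.erase i).erase j) 1 * (X i * X j) ^ a j) * g

theorem demazureOp_monomial_of_lt (a : Fin n →₀ ℕ) {i j : Fin n} (h : i ≠ j) (hlt : a i < a j) :
    demazureOp i j (monomial a 1) = -∑ s ∈ Finset.range (a j - a i - 1),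
      monomial (replaceTwo a i j (a i + 1 + s) (a j - 1 - s)) 1 := by
  apply demazureOp_eq_of_spec h
  obtain ⟨N, hN⟩ := Nat.exists_eq_add_of_lt hlt
  rw [swapVars_monomial a h]
  have ha := monomial_replaceTwo a i j (a i) (a j)
  rw [replaceTwo_self a h] at ha
  have e : ∑ s ∈ Finset.range (a j - a i - 1),
      monomial (replaceTwo a i j (a i + 1 + s) (a j - 1 - s)) (1 : ℂ)
      = monomial ((a.erase i).erase j) 1 * (X i * X j) ^ (a i + 1)
        * ∑ s ∈ Finset.range N, X i ^ s * X j ^ (N - 1 - s) := by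
    rw [Finset.mul_sum, hN, show a i + N + 1 - a i - 1 = N by omega]
    refine Finset.sum_congr rfl fun s hs => ?_
    rw [Finset.mem_range] at hs
    rw [monomial_replaceTwo, show a i + N + 1 - 1 - s = a i + 1 + (N - 1 - s) by omega]
    ring
  rw [e]
  have g := (Commute.all (X i : MvPolynomial (Fin n) ℂ) (X j)).mul_geom_sum₂ N
  simp only [ha, monomial_replaceTwo, hN]
  linear_combination (-monomial ((a.erase i).erase j) 1 * (X i * X j) ^ (a i + 1)) * g

theorem demazureOp_eq_sum_monomial {i j : Fin n} (h : i ≠ j) (f : MvPolynomial (Fin n) ℂ) :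
    demazureOp i j f = ∑ a ∈ f.support, C (coeff a f) * demazureOp i j (monomial a 1) := by
  conv_lhs => rw [f.as_sum]
  rw [← demazureOp_sum h _ _ _ fun a _ => by simp]
  simp [C_mul_monomial]

theorem exists_mem_support_of_mem_support_demazureOp {i j : Fin n} (h : i ≠ j)
    {f : MvPolynomial (Fin n) ℂ} {d : Fin n →₀ ℕ} (hd : d ∈ (demazureOp i j f).support) :
    ∃ a ∈ f.support, (∀ p, p ≠ i → p ≠ j → d p = a p) ∧ d i + d j = a i + a j ∧
      d i ≤ max (a i) (a j) ∧ d j ≤ max (a i) (a j) := by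
  rw [mem_support_iff, demazureOp_eq_sum_monomial h, coeff_sum] at hd
  obtain ⟨a, ha, hne⟩ := Finset.exists_ne_zero_of_sum_ne_zero hd
  refine ⟨a, ha, ?_⟩
  rw [coeff_C_mul] at hne
  replace hne := right_ne_zero_of_mul hne
  rcases le_or_gt (a j) (a i) with hle | hlt
  · rw [demazureOp_monomial_of_le a h hle, coeff_sum] at hne
    obtain ⟨s, hs, hne⟩ := Finset.exists_ne_zero_of_sum_ne_zero hne
    rw [coeff_monomial, ite_ne_right_iff] at hne
    rw [Finset.mem_range] at hs
    rw [← hne.1]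
    simp only [replaceTwo_apply _ h, if_true, if_neg h.symm]
    refine ⟨fun p hp hp' => by simp [hp, hp'], by omega, by omega, by omega⟩
  · rw [demazureOp_monomial_of_lt a h hlt, coeff_neg, coeff_sum] at hne
    obtain ⟨s, hs, hne⟩ := Finset.exists_ne_zero_of_sum_ne_zero (neg_ne_zero.1 hne)
    rw [coeff_monomial, ite_ne_right_iff] at hne
    rw [Finset.mem_range] at hs
    rw [← hne.1]
    simp only [replaceTwo_apply _ h, if_true, if_neg h.symm]
    refine ⟨fun p hp hp' => by simp [hp, hp'], by omega, by omega, by omega⟩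

theorem coeff_demazureOp_monomial_of_eq_zero {i j : Fin n} (h : i ≠ j) (a : Fin n →₀ ℕ)
    {d : Fin n →₀ ℕ} (hd : d i = 0) :
    coeff d (demazureOp i j (monomial a 1)) = if replaceTwo d i j (d j) 0 = a then 1 else 0 := by
  rcases le_or_gt (a j) (a i) with hle | hlt
  · rw [demazureOp_monomial_of_le a h hle, coeff_sum, Finset.sum_eq_single 0]
    · rw [coeff_monomial]
      congr 1
      simp only [Finsupp.ext_iff, replaceTwo_apply _ h, eq_iff_iff]
      constructor <;> intro H l <;> have h1 := H i <;> have h2 := H j <;> have h3 := H l <;>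
        grind
    · intro s _ hs0
      rw [coeff_monomial, if_neg]
      intro H
      have := DFunLike.congr_fun H i
      rw [replaceTwo_apply _ h, if_pos rfl] at this
      omega
    · simp
  · rw [demazureOp_monomial_of_lt a h hlt, if_neg, coeff_neg, coeff_sum, Finset.sum_eq_zero,
      neg_zero]
    · intro s _
      rw [coeff_monomial, if_neg]
      intro H
      have := DFunLike.congr_fun H i
      rw [replaceTwo_apply _ h, if_pos rfl] at this
      omega
    · intro H
      have := DFunLike.congr_fun H j
      rw [replaceTwo_apply _ h, if_neg h.symm, if_pos rfl] at this
      omega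

/-- An exponent with `d i = 0` can only be the end of a string, so it comes from one monomial, the
one with entries `i` and `j` swapped, and nothing cancels. -/
theorem coeff_demazureOp_of_eq_zero {i j : Fin n} (h : i ≠ j) (f : MvPolynomial (Fin n) ℂ)
    {d : Fin n →₀ ℕ} (hd : d i = 0) :
    coeff d (demazureOp i j f) = coeff (replaceTwo d i j (d j) 0) f := by
  rw [demazureOp_eq_sum_monomial h, coeff_sum]
  simp only [coeff_C_mul, coeff_demazureOp_monomial_of_eq_zero h _ hd]
  simp +contextual [eq_comm]

/-- The nonzero parts of `γ` weakly decrease. -/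
def NonzeroAntitone (γ : Fin n → ℕ) : Prop :=
  ∀ p q, p < q → γ p ≠ 0 → γ q ≤ γ p

theorem NonzeroAntitone.eq_zero {γ : Fin n → ℕ} (hγ : NonzeroAntitone γ) {i j : Fin n}
    (h : IsAscent γ i j) : γ i = 0 := by
  by_contra h0
  have := hγ i j (by rw [Fin.lt_def]; have := h.1; omega) h0
  have := h.2
  omega

theorem swapParts_apply_left (γ : Fin n → ℕ) (i j : Fin n) : swapParts γ i j i = γ j := by
  simp [swapParts]

theorem swapParts_apply_right (γ : Fin n → ℕ) (i j : Fin n) : swapParts γ i j j = γ i := by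
  simp [swapParts]

theorem swapParts_apply_of_ne (γ : Fin n → ℕ) {i j p : Fin n} (hi : p ≠ i) (hj : p ≠ j) :
    swapParts γ i j p = γ p := by
  simp [swapParts, Equiv.swap_apply_of_ne_of_ne hi hj]

theorem NonzeroAntitone.swapParts {γ : Fin n → ℕ} (hγ : NonzeroAntitone γ) {i j : Fin n}
    (h : IsAscent γ i j) : NonzeroAntitone (swapParts γ i j) := by
  have h0 := hγ.eq_zero h
  obtain ⟨h1, -⟩ := h
  intro p q hpq hp
  rw [Fin.lt_def] at hpq
  have key : ∀ p, SkipGroebner.swapParts γ i j p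
      = if p = i then γ j else if p = j then γ i else γ p := by
    intro p
    split_ifs with h h'
    · rw [h, swapParts_apply_left]
    · rw [h', swapParts_apply_right]
    · rw [swapParts_apply_of_ne _ h h']
  have a1 := hγ p q
  have a2 := hγ p j
  have a3 := hγ j q
  simp only [Fin.lt_def] at a1 a2 a3
  simp only [key] at hp ⊢
  simp only [Fin.ext_iff] at *
  split_ifs at hp ⊢ <;> omega

/-- Undoing an ascent lowers `weight` and preserves `NonzeroAntitone`. Each ascent moves a part past
a zero; `γ i = 0` is what makes the later support bounds survive the operator. -/
theorem NonzeroAntitone.induction {P : (Fin n → ℕ) → Prop}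
    (anti : ∀ γ, Antitone γ → P γ)
    (ascent : ∀ γ i j, NonzeroAntitone γ → IsAscent γ i j → γ i = 0 → i ≠ j →
      P (SkipGroebner.swapParts γ i j) → P γ) (γ : Fin n → ℕ) (hγ : NonzeroAntitone γ) : P γ := by
  induction hN : weight γ using Nat.strong_induction_on generalizing γ with
  | _ N ih =>
  subst hN
  by_cases hex : ∃ i j, IsAscent γ i j
  · obtain ⟨i, j, h⟩ := hex
    have hij : i ≠ j := by rintro rfl; have := h.1; omega
    exact ascent γ i j hγ h (hγ.eq_zero h) hij
      (ih _ (weight_swapParts_lt γ i j h) _ (hγ.swapParts h) rfl)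
  · apply anti
    cases n with
    | zero => exact fun a => a.elim0
    | succ m =>
      refine Fin.antitone_iff_succ_le.2 fun i => ?_
      by_contra hlt
      exact hex ⟨i.castSucc, i.succ, by simp, by omega⟩

theorem demazureChar_eq_monomial_of_antitone (γ : Fin n → ℕ) (h : Antitone γ) :
    demazureChar γ = monomial (Finsupp.equivFunOnFinite.symm γ) 1 := by
  rw [demazureChar_of_antitone γ h, monomial_eq, C_1, one_mul,
    Finsupp.prod_fintype _ _ fun _ => pow_zero _]
  simp

theorem coeff_demazureChar_self {γ : Fin n → ℕ} (hγ : NonzeroAntitone γ) :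
    coeff (Finsupp.equivFunOnFinite.symm γ) (demazureChar γ) = 1 := by
  refine NonzeroAntitone.induction (P := fun γ =>
    coeff (Finsupp.equivFunOnFinite.symm γ) (demazureChar γ) = 1) ?_ ?_ γ hγ
  · intro γ hγ
    rw [demazureChar_eq_monomial_of_antitone γ hγ, coeff_monomial, if_pos rfl]
  · intro γ i j _ hasc h0 hij ih
    rw [demazureChar_of_isAscent γ i j hasc, coeff_demazureOp_of_eq_zero hij _ (by simpa using h0),
      ← ih]
    congr 1
    ext l
    rw [replaceTwo_apply _ hij]
    simp only [Finsupp.equivFunOnFinite_symm_apply_apply]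
    split_ifs with h1 h2
    · rw [h1, swapParts_apply_left]
    · rw [h2, swapParts_apply_right, h0]
    · rw [swapParts_apply_of_ne _ h1 h2]

theorem exists_le_of_mem_support_demazureChar {γ : Fin n → ℕ} (hγ : NonzeroAntitone γ) :
    ∀ d ∈ (demazureChar γ).support, ∀ i, ∃ p, i ≤ p ∧ d i ≤ γ p := by
  refine NonzeroAntitone.induction (P := fun γ =>
    ∀ d ∈ (demazureChar γ).support, ∀ i, ∃ p, i ≤ p ∧ d i ≤ γ p) ?_ ?_ γ hγ
  · intro γ hγ d hd i
    rw [demazureChar_eq_monomial_of_antitone γ hγ, mem_support_iff, coeff_monomial,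
      ite_ne_right_iff] at hd
    exact ⟨i, le_rfl, by rw [← hd.1]; simp⟩
  · intro γ i j _ hasc h0 hij ih d hd q
    rw [demazureChar_of_isAscent γ i j hasc] at hd
    obtain ⟨a, ha, h1, h2, h3, h4⟩ := exists_mem_support_of_mem_support_demazureOp hij hd
    have bound : ∀ q, ∃ p, q ≤ p ∧ a q ≤ γ p := by
      intro q
      obtain ⟨p, hqp, hp⟩ := ih a ha q
      by_cases hpi : p = i
      · subst hpi
        refine ⟨j, hqp.trans ?_, by rwa [swapParts_apply_left] at hp⟩
        rw [Fin.le_def]; have := hasc.1; omega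
      by_cases hpj : p = j
      · subst hpj
        rw [swapParts_apply_right, h0] at hp
        exact ⟨q, le_rfl, by omega⟩
      rw [swapParts_apply_of_ne _ hpi hpj] at hp
      exact ⟨p, hqp, hp⟩
    have up : ∀ x, x ≤ max (a i) (a j) → ∃ p, j ≤ p ∧ x ≤ γ p := by
      intro x hx
      rcases le_max_iff.1 hx with hx | hx
      · obtain ⟨p, hp, hp'⟩ := bound i
        by_cases hpi : p = i
        · exact ⟨j, le_rfl, by rw [hpi] at hp'; omega⟩
        · refine ⟨p, ?_, by omega⟩
          have := hasc.1
          rw [Fin.le_def] at hp ⊢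
          have : (p : ℕ) ≠ i := fun h => hpi (Fin.ext h)
          omega
      · obtain ⟨p, hp, hp'⟩ := bound j
        exact ⟨p, hp, by omega⟩
    by_cases hqi : q = i
    · obtain ⟨p, hp, hp'⟩ := up _ h3
      refine ⟨p, ?_, hqi ▸ hp'⟩
      rw [Fin.le_def] at hp ⊢; have := hasc.1; rw [hqi]; omega
    by_cases hqj : q = j
    · rw [hqj]; exact up _ h4
    rw [h1 q hqi hqj]
    exact bound q

/-- A suffix containing both or neither of `i`, `j` is unaffected by the swap and by the operator,
which keeps the sum of the two exponents. Only the suffix starting at `j` separates them. -/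
theorem sum_le_of_mem_support_demazureChar {γ : Fin n → ℕ} (hγ : NonzeroAntitone γ) :
    ∀ d ∈ (demazureChar γ).support, ∀ i, ∑ p ∈ Finset.Ici i, d p ≤ ∑ p ∈ Finset.Ici i, γ p := by
  refine NonzeroAntitone.induction (P := fun γ =>
    ∀ d ∈ (demazureChar γ).support, ∀ i,
      ∑ p ∈ Finset.Ici i, d p ≤ ∑ p ∈ Finset.Ici i, γ p) ?_ ?_ γ hγ
  · intro γ hγ d hd i
    rw [demazureChar_eq_monomial_of_antitone γ hγ, mem_support_iff, coeff_monomial,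
      ite_ne_right_iff] at hd
    rw [← hd.1]; simp
  · intro γ i j _ hasc h0 hij ih d hd q
    rw [demazureChar_of_isAscent γ i j hasc] at hd
    obtain ⟨a, ha, h1, h2, -, -⟩ := exists_mem_support_of_mem_support_demazureOp hij hd
    have hij1 := hasc.1
    have both : ∀ q, q ≤ i → ∀ u v : Fin n → ℕ, (∀ p, p ≠ i → p ≠ j → u p = v p) →
        u i + u j = v i + v j → ∑ p ∈ Finset.Ici q, u p = ∑ p ∈ Finset.Ici q, v p := by
      intro q hq u v huv huv'
      have hi : i ∈ Finset.Ici q := by simpa using hq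
      have hj : j ∈ (Finset.Ici q).erase i := by
        rw [Fin.le_def] at hq
        simp only [Finset.mem_erase, Finset.mem_Ici, Fin.le_def]
        exact ⟨hij.symm, by omega⟩
      rw [← Finset.add_sum_erase _ _ hi, ← Finset.add_sum_erase _ _ hj,
        ← Finset.add_sum_erase _ v hi, ← Finset.add_sum_erase _ v hj, ← add_assoc, ← add_assoc,
        huv']
      congr 1
      refine Finset.sum_congr rfl fun p hp => ?_
      simp only [Finset.mem_erase] at hp
      exact huv p hp.2.1 hp.1
    have low : ∀ q, q ≤ i → ∑ p ∈ Finset.Ici q, d p ≤ ∑ p ∈ Finset.Ici q, γ p := by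
      intro q hq
      rw [both q hq d a h1 h2, ← both q hq (SkipGroebner.swapParts γ i j) γ
        (fun p hp hp' => swapParts_apply_of_ne γ hp hp')
        (by rw [swapParts_apply_left, swapParts_apply_right, add_comm])]
      exact ih a ha q
    by_cases hqi : q ≤ i
    · exact low q hqi
    by_cases hqj : q = j
    -- Since `γ i = 0`, the suffix sums of `γ` from `i` and from `j` agree, so the bound from `i`
    -- implies the one from `j`.
    · have e : Finset.Ici i = insert i (Finset.Ici j) := by
        ext p
        simp only [Finset.mem_Ici, Finset.mem_insert, Fin.le_def, Fin.ext_iff]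
        omega
      have hni : i ∉ Finset.Ici j := by simp only [Finset.mem_Ici, Fin.le_def]; omega
      have := low i le_rfl
      rw [e, Finset.sum_insert hni, Finset.sum_insert hni, h0] at this
      rw [hqj]; omega
    have hgt : ∀ p ∈ Finset.Ici q, p ≠ i ∧ p ≠ j := by
      intro p hp
      simp only [Finset.mem_Ici, Fin.le_def, Fin.ext_iff] at *
      simp only [ne_eq, Fin.ext_iff]
      omega
    calc ∑ p ∈ Finset.Ici q, d p = ∑ p ∈ Finset.Ici q, a p :=
          Finset.sum_congr rfl fun p hp => h1 p (hgt p hp).1 (hgt p hp).2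
      _ ≤ ∑ p ∈ Finset.Ici q, SkipGroebner.swapParts γ i j p := ih a ha q
      _ = ∑ p ∈ Finset.Ici q, γ p :=
          Finset.sum_congr rfl fun p hp => swapParts_apply_of_ne γ (hgt p hp).1 (hgt p hp).2

end Support
/-! ### Products of linear and geometric series -/

section Series

variable {A : Type*} [CommRing A]

/-- The series `1 - a t`. -/
def linSeries (a : A) : PowerSeries A := 1 - PowerSeries.C a * PowerSeries.X

/-- The geometric series `1 / (1 - a t)`. -/
def geomSeries (a : A) : PowerSeries A := PowerSeries.mk fun c => a ^ c

theorem linSeries_mul_geomSeries (a : A) : linSeries a * geomSeries a = 1 := by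
  ext c
  rw [linSeries, sub_mul, one_mul, mul_assoc, map_sub, PowerSeries.coeff_C_mul]
  cases c with
  | zero => simp [geomSeries]
  | succ c => simp [geomSeries, PowerSeries.coeff_succ_X_mul, PowerSeries.coeff_one, pow_succ']

theorem prod_linSeries_mul_prod_geomSeries {ι : Type*} (s : Finset ι) (f : ι → A) :
    (∏ p ∈ s, linSeries (f p)) * ∏ p ∈ s, geomSeries (f p) = 1 := by
  rw [← Finset.prod_mul_distrib, Finset.prod_eq_one fun p _ => linSeries_mul_geomSeries _]

theorem geomSeries_mul_geomSeries (a b : A) :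
    (PowerSeries.C a - PowerSeries.C b) * (geomSeries a * geomSeries b)
      = PowerSeries.C a * geomSeries a - PowerSeries.C b * geomSeries b := by
  have ha := linSeries_mul_geomSeries a
  have hb := linSeries_mul_geomSeries b
  unfold linSeries at ha hb
  linear_combination PowerSeries.C a * geomSeries a * hb - PowerSeries.C b * geomSeries b * ha

theorem map_linSeries {B : Type*} [CommRing B] (φ : A →+* B) (a : A) :
    PowerSeries.map φ (linSeries a) = linSeries (φ a) := by
  simp [linSeries]

theorem map_geomSeries {B : Type*} [CommRing B] (φ : A →+* B) (a : A) :
    PowerSeries.map φ (geomSeries a) = geomSeries (φ a) := by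
  ext; simp [geomSeries]

theorem coeff_prod_linSeries {ι : Type*} (s : Finset ι) (f : ι → A) (c : ℕ) :
    PowerSeries.coeff c (∏ p ∈ s, linSeries (f p))
      = (-1) ^ c * ∑ t ∈ s.powersetCard c, ∏ p ∈ t, f p := by
  classical
  have e : ∏ p ∈ s, linSeries (f p)
      = ∑ t ∈ s.powerset, PowerSeries.C (∏ p ∈ t, -f p) * PowerSeries.X ^ t.card := by
    simp only [linSeries, sub_eq_add_neg, Finset.prod_one_add]
    refine Finset.sum_congr rfl fun t _ => ?_
    rw [map_prod, ← Finset.prod_const, ← Finset.prod_mul_distrib]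
    exact Finset.prod_congr rfl fun p _ => by simp
  rw [e, map_sum, Finset.mul_sum, Finset.powersetCard_eq_filter, Finset.sum_filter]
  refine Finset.sum_congr rfl fun t _ => ?_
  rw [PowerSeries.coeff_C_mul, PowerSeries.coeff_X_pow, Finset.prod_neg]
  split_ifs with h1 h2 h2
  · rw [h1, mul_one]
  · exact absurd h1.symm h2
  · exact absurd h2.symm h1
  · simp

theorem coeff_prod_linSeries_of_card_lt {ι : Type*} {s : Finset ι} (f : ι → A) {c : ℕ}
    (h : s.card < c) : PowerSeries.coeff c (∏ p ∈ s, linSeries (f p)) = 0 := by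
  rw [coeff_prod_linSeries, Finset.powersetCard_eq_empty.2 h]
  simp

/-- Turns a row of series coefficients times a column of coefficients of a polynomial of degree at
most `j` into one coefficient of a product, so that matrix products become cancellations of series.
-/
theorem sum_coeff_mul_coeff {m : ℕ} (F G : PowerSeries A) (N : ℕ) (j : Fin m)
    (hG : ∀ c, (j : ℕ) < c → PowerSeries.coeff c G = 0) :
    ∑ l : Fin m, PowerSeries.coeff (N + l) F
        * (if l ≤ j then PowerSeries.coeff ((j : ℕ) - l) G else 0)
      = PowerSeries.coeff (N + j) (F * G) := by
  rw [mul_comm F G, PowerSeries.coeff_mul, Finset.Nat.sum_antidiagonal_eq_sum_range_succ_mk]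
  have e : ∀ c ∈ Finset.range (N + j).succ, c ∉ Finset.range (j + 1) →
      PowerSeries.coeff c G * PowerSeries.coeff (N + j - c) F = 0 := by
    intro c _ hc
    rw [hG c (by simpa using hc), zero_mul]
  rw [← Finset.sum_subset (Finset.range_subset_range.2 (by omega)) e]
  simp only [mul_ite, mul_zero]
  rw [← Finset.sum_filter]
  refine Finset.sum_bij' (fun l _ => (j : ℕ) - l) (fun c _ => ⟨j - c, by omega⟩) ?_ ?_ ?_ ?_ ?_
  · intro l _; rw [Finset.mem_range]; omega
  · exact fun c _ => Finset.mem_filter.2 ⟨Finset.mem_univ _, Fin.le_def.2 (Nat.sub_le _ _)⟩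
  · intro l hl
    simp only [Finset.mem_filter, Fin.le_def] at hl
    ext; simp only; omega
  · intro c hc; simp only [Finset.mem_range] at hc; simp only; omega
  · intro l hl
    simp only [Finset.mem_filter, Fin.le_def] at hl
    rw [mul_comm]; congr 3; omega

end Series

/-! ### The determinantal formula -/

section JacobiTrudi

variable {n : ℕ}

/-- The generating series of the complete homogeneous polynomials in `x_p`, `p ≤ b`. -/
def flagSeries (b : Fin n) : PowerSeries (MvPolynomial (Fin n) ℂ) :=
  ∏ p ∈ Finset.Iic b, geomSeries (X p)

/-- The operator adds one variable to a complete homogeneous polynomial, by the partial fraction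
identity `geomSeries_mul_geomSeries`. -/
theorem demazureOp_coeff_flagSeries {p q : Fin n} (h : (p : ℕ) + 1 = q) (i N : ℕ) :
    demazureOp p q (PowerSeries.coeff N (PowerSeries.X ^ i * flagSeries p))
      = PowerSeries.coeff N (PowerSeries.X ^ i * flagSeries q) := by
  have hpq : p ≠ q := by rintro rfl; omega
  apply demazureOp_eq_of_spec hpq
  set K : PowerSeries (MvPolynomial (Fin n) ℂ) := ∏ l ∈ Finset.Iio p, geomSeries (X l)
  have hp : flagSeries p = geomSeries (X p) * K := by
    have : Finset.Iic p = insert p (Finset.Iio p) := by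
      ext l; simp only [Finset.mem_Iic, Finset.mem_insert, Finset.mem_Iio, le_iff_eq_or_lt]
    rw [flagSeries, this, Finset.prod_insert (by simp)]
  have hq : flagSeries q = geomSeries (X q) * flagSeries p := by
    have : Finset.Iic q = insert q (Finset.Iic p) := by
      ext l
      simp only [Finset.mem_Iic, Finset.mem_insert, Fin.le_def, Fin.ext_iff]
      omega
    rw [flagSeries, this, Finset.prod_insert]
    · rfl
    · simp only [Finset.mem_Iic, Fin.le_def]; omega
  have hs : PowerSeries.map (swapVars p q : _ →+* MvPolynomial (Fin n) ℂ) (flagSeries p)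
      = geomSeries (X q) * K := by
    rw [hp, map_mul, map_prod, map_geomSeries]
    congr 1
    · simp
    · refine Finset.prod_congr rfl fun l hl => ?_
      rw [map_geomSeries]
      rw [Finset.mem_Iio, Fin.lt_def] at hl
      simp only [RingHom.coe_coe, rename_X]
      rw [Equiv.swap_apply_of_ne_of_ne] <;> rw [ne_eq, Fin.ext_iff] <;> omega
  have hc : swapVars p q (PowerSeries.coeff N (PowerSeries.X ^ i * flagSeries p))
      = PowerSeries.coeff N (PowerSeries.X ^ i * (geomSeries (X q) * K)) := by
    rw [← hs]
    have := PowerSeries.coeff_map (swapVars p q : _ →+* MvPolynomial (Fin n) ℂ) N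
      (PowerSeries.X ^ i * flagSeries p)
    rw [map_mul, map_pow, PowerSeries.map_X] at this
    rw [this]; rfl
  rw [hc, ← PowerSeries.coeff_C_mul, ← PowerSeries.coeff_C_mul, ← PowerSeries.coeff_C_mul,
    ← map_sub]
  congr 1
  rw [hq, hp, map_sub]
  linear_combination (PowerSeries.X ^ i * K) *
    geomSeries_mul_geomSeries (X p : MvPolynomial (Fin n) ℂ) (X q)

theorem swapVars_coeff_flagSeries {p q b : Fin n} (h : (p : ℕ) + 1 = q) (hb : b ≠ p) (i N : ℕ) :
    swapVars p q (PowerSeries.coeff N (PowerSeries.X ^ i * flagSeries b))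
      = PowerSeries.coeff N (PowerSeries.X ^ i * flagSeries b) := by
  have hs : PowerSeries.map (swapVars p q : _ →+* MvPolynomial (Fin n) ℂ) (flagSeries b)
      = flagSeries b := by
    rw [flagSeries, map_prod]
    refine Finset.prod_bijective (Equiv.swap p q) (Equiv.bijective _) ?_ ?_
    · intro l
      have hb' : (b : ℕ) ≠ p := fun h => hb (Fin.ext h)
      simp only [Finset.mem_Iic, Fin.le_def]
      by_cases h1 : l = p
      · subst h1; rw [Equiv.swap_apply_left]; omega
      by_cases h2 : l = q
      · subst h2; rw [Equiv.swap_apply_right]; omega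
      rw [Equiv.swap_apply_of_ne_of_ne h1 h2]
    · intro l _
      rw [map_geomSeries]
      simp
  have := PowerSeries.coeff_map (swapVars p q : _ →+* MvPolynomial (Fin n) ℂ) N
    (PowerSeries.X ^ i * flagSeries b)
  rw [map_mul, map_pow, PowerSeries.map_X, hs] at this
  exact this.symm

/-- The flagged Jacobi-Trudi matrix. -/
def jacobiTrudi {m : ℕ} (b : Fin m → Fin n) (lam : Fin m → ℕ) :
    Matrix (Fin m) (Fin m) (MvPolynomial (Fin n) ℂ) :=
  Matrix.of fun i j =>
    -- The entry is `h_{lam i + j - i}` in the variables up to `b i`; the factor `X ^ i` replaces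
    -- the subtraction and gives 0 at negative indices.
    PowerSeries.coeff (lam i + j) (PowerSeries.X ^ (i : ℕ) * flagSeries (b i))

/-- The composition with part `lam j` in position `b j`. -/
def placeParts {m : ℕ} (b : Fin m → Fin n) (lam : Fin m → ℕ) (p : Fin n) : ℕ :=
  ∑ j, if b j = p then lam j else 0

theorem placeParts_apply {m : ℕ} {b : Fin m → Fin n} (hb : Function.Injective b)
    (lam : Fin m → ℕ) (j : Fin m) : placeParts b lam (b j) = lam j := by
  simp [placeParts, hb.eq_iff]

theorem placeParts_eq_zero {m : ℕ} {b : Fin m → Fin n} (lam : Fin m → ℕ) {p : Fin n}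
    (hp : ∀ j, b j ≠ p) : placeParts b lam p = 0 := by
  simp [placeParts, hp]

/-- Expand along row `j`: since no flag bound equals `p`, all other rows, hence the cofactors, are
symmetric in `x_p` and its successor. The operator thus acts on row `j` alone and raises its flag
bound. -/
theorem demazureOp_det_jacobiTrudi {m : ℕ} (b : Fin m → Fin n) (lam : Fin m → ℕ) (j : Fin m)
    {p : Fin n} (hp : (p : ℕ) + 1 = b j) (hbp : ∀ l, b l ≠ p) :
    demazureOp p (b j) (jacobiTrudi (Function.update b j p) lam).det = (jacobiTrudi b lam).det := by
  have hne : p ≠ b j := fun h => by rw [← h] at hp; omega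
  have hrow : ∀ v, (jacobiTrudi (Function.update b j p) lam).updateRow j v
      = (jacobiTrudi b lam).updateRow j v := by
    intro v
    ext1 i l
    by_cases hi : i = j
    · subst hi; simp
    · rw [Matrix.updateRow_ne hi, Matrix.updateRow_ne hi]
      simp [jacobiTrudi, Function.update_of_ne hi]
  rw [Matrix.det_eq_sum_mul_adjugate_row _ j, Matrix.det_eq_sum_mul_adjugate_row _ j]
  simp only [Matrix.adjugate_apply, hrow]
  simp only [mul_comm _ (Matrix.det _)]
  rw [demazureOp_sum hne]
  · refine Finset.sum_congr rfl fun l _ => ?_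
    congr 1
    simp only [jacobiTrudi, Matrix.of_apply, Function.update_self]
    exact demazureOp_coeff_flagSeries hp _ _
  · intro l _
    rw [AlgHom.map_det]
    congr 1
    ext1 i c
    rw [AlgHom.mapMatrix_apply, Matrix.map_apply]
    by_cases hi : i = j
    · subst hi
      rw [Matrix.updateRow_self]
      by_cases hcl : c = l
      · subst hcl; simp
      · simp [hcl]
    · rw [Matrix.updateRow_ne hi]
      exact swapVars_coeff_flagSeries hp (hbp i) _ _

theorem flagSeries_mul_prod_linSeries {b : Fin n} {s : Finset (Fin n)} (h : Finset.Iic b ⊆ s) :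
    flagSeries b * ∏ p ∈ s, linSeries (X p) = ∏ p ∈ s \ Finset.Iic b, linSeries (X p) := by
  rw [← Finset.prod_sdiff h, flagSeries, mul_left_comm, mul_comm (∏ p ∈ Finset.Iic b, _),
    prod_linSeries_mul_prod_geomSeries, mul_one]

/-- Right multiplication by the unitriangular matrix of coefficients of `∏_{p<j} (1 - x_p t)` makes
the matrix lower triangular: above the diagonal the product series is `t^i` times a polynomial of
degree `j - i - 1`, too small to reach `t^(lam i + j)`. On the diagonal `1 / (1 - x_i t)` remains.
-/
theorem det_jacobiTrudi_of_eq {m : ℕ} (b : Fin m → Fin n) (hb : ∀ j, (b j : ℕ) = j)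
    (lam : Fin m → ℕ) :
    (jacobiTrudi b lam).det = ∏ j, X (b j) ^ lam j := by
  let G : Fin m → PowerSeries (MvPolynomial (Fin n) ℂ) :=
    fun j => ∏ p ∈ Finset.Iio (b j), linSeries (X p)
  let U : Matrix (Fin m) (Fin m) (MvPolynomial (Fin n) ℂ) :=
    Matrix.of fun l j => if l ≤ j then PowerSeries.coeff ((j : ℕ) - l) (G j) else 0
  have hU : U.det = 1 := by
    rw [Matrix.det_of_isUpperTriangular]
    · refine Finset.prod_eq_one fun j _ => ?_
      simp [U, G, map_prod, linSeries]
    · intro l j hlj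
      exact if_neg (not_le.2 hlj)
  have hG : ∀ (j : Fin m) (c : ℕ), (j : ℕ) < c → PowerSeries.coeff c (G j) = 0 := by
    intro j c hc
    apply coeff_prod_linSeries_of_card_lt
    rw [Fin.card_Iio, hb]; exact hc
  have hMU : ∀ i j, (jacobiTrudi b lam * U) i j = PowerSeries.coeff (lam i + j)
      (PowerSeries.X ^ (i : ℕ) * flagSeries (b i) * G j) := by
    intro i j
    rw [Matrix.mul_apply, ← sum_coeff_mul_coeff _ _ _ _ (hG j)]
    rfl
  rw [← mul_one (Matrix.det _), ← hU, ← Matrix.det_mul, Matrix.det_of_isLowerTriangular]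
  · refine Finset.prod_congr rfl fun i _ => ?_
    have e : flagSeries (b i) * G i = geomSeries (X (b i)) := by
      have : Finset.Iic (b i) = insert (b i) (Finset.Iio (b i)) := by
        ext l; simp only [Finset.mem_Iic, Finset.mem_insert, Finset.mem_Iio, le_iff_eq_or_lt]
      rw [flagSeries, this, Finset.prod_insert (by simp), mul_assoc,
        mul_comm (∏ p ∈ Finset.Iio (b i), _), prod_linSeries_mul_prod_geomSeries, mul_one]
    rw [hMU, mul_assoc, e, PowerSeries.coeff_X_pow_mul, geomSeries, PowerSeries.coeff_mk]
  · intro i j hij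
    replace hij : i < j := hij
    rw [hMU, mul_assoc, flagSeries_mul_prod_linSeries, PowerSeries.coeff_X_pow_mul',
      if_pos (by rw [Fin.lt_def] at hij; omega), coeff_prod_linSeries_of_card_lt]
    · rw [Finset.card_sdiff_of_subset, Fin.card_Iio, Fin.card_Iic, hb, hb]
      · rw [Fin.lt_def] at hij; omega
      · intro l
        simp only [Finset.mem_Iic, Finset.mem_Iio, Fin.le_def, Fin.lt_def, hb] at hij ⊢
        omega
    · intro l
      simp only [Finset.mem_Iic, Finset.mem_Iio, Fin.le_def, Fin.lt_def, hb] at hij ⊢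
      omega

theorem demazureChar_placeParts {m : ℕ} (b : Fin m → Fin n) (hb : StrictMono b)
    (lam : Fin m → ℕ) (hlam : Antitone lam) (hpos : ∀ j, 0 < lam j) :
    demazureChar (placeParts b lam) = (jacobiTrudi b lam).det := by
  induction hN : ∑ j, (b j : ℕ) using Nat.strong_induction_on generalizing b with
  | _ N ih =>
  subst hN
  have hle : ∀ j : Fin m, (j : ℕ) ≤ b j := fun j => by
    obtain ⟨j, hj⟩ := j
    induction j with
    | zero => exact Nat.zero_le _
    | succ j ihj =>
      have h1 := ihj (by omega)
      have h2 : b ⟨j, by omega⟩ < b ⟨j + 1, hj⟩ := hb (by simp [Fin.lt_def])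
      rw [Fin.lt_def] at h2
      simp only at h1 ⊢
      omega
  by_cases hall : ∀ j, (b j : ℕ) = j
  · rw [det_jacobiTrudi_of_eq b hall, demazureChar_of_antitone]
    · rw [← Finset.prod_subset (Finset.subset_univ (Finset.univ.image b)),
        Finset.prod_image fun x _ y _ h => hb.injective h]
      · exact Finset.prod_congr rfl fun j _ => by rw [placeParts_apply hb.injective]
      · intro p _ hp
        rw [placeParts_eq_zero, pow_zero]
        simpa using hp
    · intro p q hpq
      by_cases hq : ∃ j, b j = q
      · obtain ⟨j, rfl⟩ := hq
        have hpj : (p : ℕ) ≤ j := by rw [← hall j]; exact hpq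
        have hp : p = b ⟨p, by omega⟩ := Fin.ext (hall ⟨p, by omega⟩).symm
        rw [hp, placeParts_apply hb.injective, placeParts_apply hb.injective]
        exact hlam hpj
      · rw [placeParts_eq_zero lam (by simpa using hq)]
        exact Nat.zero_le _
  -- The first part not pushed fully left has an empty position just before it, hence an ascent
  -- there; undoing it lowers the sum of positions.
  · obtain ⟨j, hj, hmin⟩ : ∃ j, (b j : ℕ) ≠ j ∧ ∀ l, l < j → (b l : ℕ) = l := by
      obtain ⟨j, hj, hj'⟩ := WellFounded.has_min (wellFounded_lt (α := Fin m))
        {j | (b j : ℕ) ≠ j} (by simpa [Set.Nonempty] using hall)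
      exact ⟨j, hj, fun l hl => by by_contra h; exact hj' l h hl⟩
    have hj1 : (j : ℕ) < b j := lt_of_le_of_ne (hle j) (Ne.symm hj)
    obtain ⟨p, hp⟩ : ∃ p : Fin n, (p : ℕ) + 1 = b j :=
      ⟨⟨(b j : ℕ) - 1, by omega⟩, by simp only; omega⟩
    have hbelow : ∀ l, l < j → b l < p := by
      intro l hl
      rw [Fin.lt_def, hmin l hl]
      rw [Fin.lt_def] at hl
      omega
    have habove : ∀ l, j < l → b j < b l := fun l hl => hb hl
    have hbp : ∀ l, b l ≠ p := by
      intro l h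
      rcases lt_trichotomy l j with hl | hl | hl
      · exact absurd h (hbelow l hl).ne
      · rw [← h, hl] at hp; omega
      · have := habove l hl
        rw [h, Fin.lt_def] at this; omega
    have hb' : StrictMono (Function.update b j p) := by
      intro x y hxy
      by_cases hx : x = j
      · subst hx
        rw [Function.update_self, Function.update_of_ne hxy.ne']
        have := habove y hxy
        rw [Fin.lt_def] at this ⊢; omega
      · rw [Function.update_of_ne hx]
        by_cases hy : y = j
        · subst hy
          rw [Function.update_self]; exact hbelow x hxy
        · rw [Function.update_of_ne hy]; exact hb hxy
    have hzero : placeParts b lam p = 0 := placeParts_eq_zero lam hbp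
    have hasc : IsAscent (placeParts b lam) p (b j) :=
      ⟨hp, by rw [hzero, placeParts_apply hb.injective]; exact hpos j⟩
    have hswap : swapParts (placeParts b lam) p (b j)
        = placeParts (Function.update b j p) lam := by
      funext q
      by_cases hq1 : q = p
      · subst hq1
        rw [swapParts_apply_left, placeParts_apply hb.injective]
        have := placeParts_apply hb'.injective lam j
        rw [Function.update_self] at this
        exact this.symm
      by_cases hq2 : q = b j
      · subst hq2
        rw [swapParts_apply_right, hzero, placeParts_eq_zero]
        intro l h
        by_cases hl : l = j
        · subst hl; rw [Function.update_self] at h; exact hq1 h.symm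
        · rw [Function.update_of_ne hl] at h; exact hl (hb.injective h)
      · rw [swapParts_apply_of_ne _ hq1 hq2]
        refine Finset.sum_congr rfl fun l _ => ?_
        by_cases hl : l = j
        · subst hl
          rw [Function.update_self, if_neg (Ne.symm hq2), if_neg (Ne.symm hq1)]
        · rw [Function.update_of_ne hl]
    have hlt : ∑ l, (Function.update b j p l : ℕ) < ∑ l, (b l : ℕ) := by
      apply Finset.sum_lt_sum
      · intro l _
        by_cases hl : l = j
        · subst hl; rw [Function.update_self]; omega
        · rw [Function.update_of_ne hl]
      · exact ⟨j, Finset.mem_univ _, by rw [Function.update_self]; omega⟩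
    rw [demazureChar_of_isAscent _ _ _ hasc, hswap, ih _ hlt _ hb' rfl,
      demazureOp_det_jacobiTrudi b lam j hp hbp]

/-- Modulo `I` the polynomial `∏ (1 - x_p t)` has degree below `m`, and its coefficients form a
vector killed by the matrix. Multiplying by the adjugate kills the determinant, as the last entry of
the vector is 1. The hypothesis `hlam` says that `t^i ∏_{p > b i} (1 - x_p t)` has degree below `lam
i + m - 1`. -/
theorem det_jacobiTrudi_mem {m : ℕ} (b : Fin m → Fin n) (lam : Fin m → ℕ)
    (hlam : ∀ j, n + j ≤ lam j + (m - 1) + b j) (hm : 0 < m)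
    (I : Ideal (MvPolynomial (Fin n) ℂ)) (hI : ∀ d, m ≤ d → d ≤ n → esymm (Fin n) ℂ d ∈ I) :
    (jacobiTrudi b lam).det ∈ I := by
  set φ := Ideal.Quotient.mk I
  rw [← Ideal.Quotient.eq_zero_iff_mem, RingHom.map_det]
  set M := φ.mapMatrix (jacobiTrudi b lam)
  let G : PowerSeries (MvPolynomial (Fin n) ℂ) := ∏ p : Fin n, linSeries (X p)
  let last : Fin m := ⟨m - 1, by omega⟩
  have hG : ∀ c, (last : ℕ) < c → PowerSeries.coeff c (PowerSeries.map φ G) = 0 := by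
    intro c hc
    replace hc : m ≤ c := by simp only [last] at hc; omega
    rw [PowerSeries.coeff_map]
    by_cases hcn : c ≤ n
    · rw [coeff_prod_linSeries, map_mul]
      have := Ideal.Quotient.eq_zero_iff_mem.2 (hI c hc hcn)
      rw [esymm] at this
      rw [this, mul_zero]
    · rw [coeff_prod_linSeries_of_card_lt, map_zero]
      simpa using hcn
  let v : Fin m → MvPolynomial (Fin n) ℂ ⧸ I := fun l =>
    if l ≤ last then PowerSeries.coeff ((last : ℕ) - l) (PowerSeries.map φ G) else 0
  have hMv : M.mulVec v = 0 := by
    funext i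
    have e : M.mulVec v i = PowerSeries.coeff (lam i + last)
        (PowerSeries.map φ (PowerSeries.X ^ (i : ℕ) * flagSeries (b i)) * PowerSeries.map φ G) := by
      rw [← sum_coeff_mul_coeff _ _ _ _ hG]
      simp only [PowerSeries.coeff_map]
      rfl
    rw [e, ← map_mul, PowerSeries.coeff_map, mul_assoc,
      flagSeries_mul_prod_linSeries (Finset.subset_univ _), PowerSeries.coeff_X_pow_mul']
    have h1 := hlam i
    have h2 : (last : ℕ) = m - 1 := rfl
    have h3 := (b i).isLt
    split_ifs
    · rw [coeff_prod_linSeries_of_card_lt, map_zero]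
      · rfl
      rw [Finset.card_sdiff_of_subset (Finset.subset_univ _), Fin.card_Iic, Finset.card_univ,
        Fintype.card_fin]
      omega
    · simp
  have h := congrArg (fun w => (M.adjugate.mulVec w) last) hMv
  simp only [Matrix.mulVec_mulVec, Matrix.adjugate_mul, Matrix.smul_mulVec, Matrix.one_mulVec,
    Matrix.mulVec_zero, Pi.smul_apply, Pi.zero_apply, smul_eq_mul] at h
  have hv : v last = 1 := by
    simp [v, G, linSeries, map_prod]
  rwa [hv, mul_one] at h

end JacobiTrudi
/-! ### Point sets and their standard exponents -/

section Points

/-- Reading an exponent from left to right with threshold `(k + 1 - u) r`, where `u` counts the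
entries below the threshold which are still required; each such entry raises the threshold by `r`.
The exponent is standard if the required number of such entries occurs. -/
def IsStandard (k r : ℕ) : (n : ℕ) → ℕ → (Fin n → ℕ) → Prop
  | 0, u, _ => u = 0
  | n + 1, u, d =>
    (((k + 1 - u) * r ≤ d 0 → IsStandard k r n u (Fin.tail d)) ∧
      (d 0 < (k + 1 - u) * r → IsStandard k r n (u - 1) (Fin.tail d)))

open scoped Classical in
/-- The elements of `A` which are `r`-th powers of coordinates of `x`. -/
def hit {n : ℕ} (A : Finset ℂ) (r : ℕ) (x : Fin n → ℂ) : Finset ℂ :=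
  A.filter fun a => ∃ i, x i ^ r = a

/-- Induction on the number of variables, for points meeting at least `u` elements of `A`. Read `F`
as a polynomial in the first variable, and show its coefficients vanish at enough tails `w`. -/
theorem eq_zero_of_eval_eq_zero {r : ℕ} (A V : Finset ℂ)
    (hV : ∀ B ⊆ A, B.card * r ≤ (V.filter fun v => v ^ r ∈ B).card) (n u : ℕ)
    (F : MvPolynomial (Fin n) ℂ)
    (hF : ∀ d ∈ F.support, (∀ i, d i < V.card) ∧ IsStandard A.card r n u d)
    (h : ∀ x : Fin n → ℂ, (∀ i, x i ∈ V) → u ≤ (hit A r x).card → eval x F = 0) : F = 0 := by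
  classical
  induction n generalizing u with
  | zero =>
    ext d
    by_contra hd
    have hu : u = 0 := (hF d (mem_support_iff.2 hd)).2
    have h0 := h (fun i => i.elim0) (fun i => i.elim0) (by omega)
    rw [eq_C_of_isEmpty F, eval_C] at h0
    rw [Subsingleton.elim d 0, h0, coeff_zero] at hd
    exact hd rfl
  | succ n ih =>
    set P := finSuccEquiv ℂ n F with hP
    have hcoeff : ∀ e d, coeff d (P.coeff e) = coeff (d.cons e) F :=
      fun e d => finSuccEquiv_coeff_coeff d F e
    have hstd : ∀ e, ∀ d ∈ (P.coeff e).support, e < V.card ∧ (∀ i, d i < V.card) ∧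
        ((A.card + 1 - u) * r ≤ e → IsStandard A.card r n u d) ∧
        (e < (A.card + 1 - u) * r → IsStandard A.card r n (u - 1) d) := by
      intro e d hd
      rw [mem_support_iff, hcoeff, ← mem_support_iff] at hd
      obtain ⟨h1, h2⟩ := hF _ hd
      have ht : Fin.tail (d.cons e : Fin (n + 1) → ℕ) = d := by
        funext i; simp [Fin.tail]
      simp only [IsStandard, ht, Finsupp.cons_zero] at h2
      exact ⟨by simpa using h1 0, fun i => by simpa using h1 i.succ, h2⟩
    have heval : ∀ w v, eval (Fin.cons v w : Fin (n + 1) → ℂ) F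
        = Polynomial.eval v (P.map (eval w)) := fun w v => eval_eq_eval_mv_eval' w v F
    have hvanish : ∀ (w : Fin n → ℂ) (T : Finset ℂ), (∀ i, w i ∈ V) → T ⊆ V →
        (∀ v ∈ T, u ≤ (hit A r (Fin.cons v w : Fin (n + 1) → ℂ)).card) →
        (∀ e, T.card ≤ e → eval w (P.coeff e) = 0) → ∀ e, eval w (P.coeff e) = 0 := by
      intro w T hw hT hhit hdeg e
      have : P.map (eval w) = 0 := by
        refine Polynomial.eq_zero_of_degree_lt_of_eval_finset_eq_zero T ?_ ?_
        · rw [Polynomial.degree_lt_iff_coeff_zero]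
          intro e he
          rw [Polynomial.coeff_map]
          exact hdeg e he
        · intro v hv
          rw [← heval]
          refine h _ (fun i => ?_) (hhit v hv)
          refine Fin.cases ?_ (fun i => ?_) i
          · exact hT hv
          · exact hw i
      rw [← Polynomial.coeff_map, this, Polynomial.coeff_zero]
    have hcons : ∀ (w : Fin n → ℂ) (v : ℂ),
        hit A r w ⊆ hit A r (Fin.cons v w : Fin (n + 1) → ℂ) := by
      intro w v a ha
      simp only [hit, Finset.mem_filter] at ha ⊢
      obtain ⟨ha, i, hi⟩ := ha
      exact ⟨ha, i.succ, by simpa using hi⟩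
    -- If the tail already meets `u` elements, the first coordinate is free in `V`, and `F` has
    -- degree below `|V|` in it.
    have hfull : ∀ w : Fin n → ℂ, (∀ i, w i ∈ V) → u ≤ (hit A r w).card →
        ∀ e, eval w (P.coeff e) = 0 := by
      intro w hw hu
      refine hvanish w V hw subset_rfl
        (fun v _ => hu.trans (Finset.card_le_card (hcons w v))) fun e he => ?_
      have : P.coeff e = 0 := by
        by_contra hne
        obtain ⟨d, hd⟩ := Finset.nonempty_iff_ne_empty.2 (mt support_eq_empty.1 hne)
        have := (hstd e d hd).1
        omega
      rw [this, map_zero]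
    have hhigh : ∀ e, (A.card + 1 - u) * r ≤ e → P.coeff e = 0 := fun e he =>
      ih u _ (fun d hd => ⟨(hstd e d hd).2.1, (hstd e d hd).2.2.1 he⟩)
        fun w hw hu => hfull w hw hu e
    have hall : ∀ e, P.coeff e = 0 := by
      intro e
      by_cases he : (A.card + 1 - u) * r ≤ e
      · exact hhigh e he
      refine ih (u - 1) _ (fun d hd => ⟨(hstd e d hd).2.1, (hstd e d hd).2.2.2 (by omega)⟩)
        fun w hw hu => ?_
      by_cases hu' : u ≤ (hit A r w).card
      · exact hfull w hw hu' e
      -- Here the tail meets exactly `u - 1` elements. The first coordinate must be a root of one of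
      -- the `|A| + 1 - u` missed elements: at least as many values as the threshold, which by
      -- `hhigh` exceeds the degree in the first variable.
      have hsub : A \ hit A r w ⊆ A := Finset.sdiff_subset
      have hcard : (A \ hit A r w).card = A.card + 1 - u := by
        have h1 : hit A r w ⊆ A := Finset.filter_subset _ _
        have h2 := Finset.card_le_card h1
        rw [Finset.card_sdiff_of_subset h1]
        omega
      refine hvanish w (V.filter fun v => v ^ r ∈ A \ hit A r w) hw (Finset.filter_subset _ _)
        ?_ ?_ e
      · intro v hv
        simp only [Finset.mem_filter, Finset.mem_sdiff] at hv
        have : insert (v ^ r) (hit A r w) ⊆ hit A r (Fin.cons v w : Fin (n + 1) → ℂ) := by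
          refine Finset.insert_subset ?_ (hcons w v)
          simp only [hit, Finset.mem_filter]
          exact ⟨hv.2.1, 0, rfl⟩
        have := Finset.card_le_card this
        rw [Finset.card_insert_of_notMem hv.2.2] at this
        omega
      · intro e' he'
        have := hV _ hsub
        rw [hcard] at this
        rw [hhigh e' (this.trans he'), map_zero]
    have : P = 0 := Polynomial.ext fun e => by rw [hall e, Polynomial.coeff_zero]
    exact (map_eq_zero_iff _ (finSuccEquiv ℂ n).injective).1 this

end Points

/-! ### Top forms of polynomials vanishing on a point set -/

section TopForms

variable {n : ℕ}

/-- The ideal of polynomials all of whose homogeneous components are top-degree forms of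
polynomials vanishing on `Y`. -/
def topFormIdeal (Y : Set (Fin n → ℂ)) : Ideal (MvPolynomial (Fin n) ℂ) where
  carrier := {f | ∀ D, ∃ F : MvPolynomial (Fin n) ℂ, (∀ x ∈ Y, eval x F = 0) ∧
    ∀ d : Fin n →₀ ℕ, D ≤ d.degree → coeff d F = if d.degree = D then coeff d f else 0}
  zero_mem' D := ⟨0, by simp, by simp⟩
  add_mem' {f g} hf hg D := by
    obtain ⟨F, hF, hF'⟩ := hf D
    obtain ⟨G, hG, hG'⟩ := hg D
    refine ⟨F + G, fun x hx => by rw [map_add, hF x hx, hG x hx, add_zero], fun d hd => ?_⟩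
    rw [coeff_add, hF' d hd, hG' d hd]
    split_ifs <;> simp
  smul_mem' c f hf := by
    rw [smul_eq_mul]
    induction c using MvPolynomial.induction_on' with
    | add p q hp hq =>
      intro D
      obtain ⟨F, hF, hF'⟩ := hp D
      obtain ⟨G, hG, hG'⟩ := hq D
      refine ⟨F + G, fun x hx => by rw [map_add, hF x hx, hG x hx, add_zero], fun d hd => ?_⟩
      rw [coeff_add, hF' d hd, hG' d hd, add_mul]
      split_ifs <;> simp
    | monomial s a =>
      intro D
      -- If the monomial has degree above `D`, the product has no component of degree `D` and `F =
      -- 0` serves.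
      by_cases hs : s.degree ≤ D
      · obtain ⟨F, hF, hF'⟩ := hf (D - s.degree)
        refine ⟨monomial s a * F, fun x hx => by rw [map_mul, hF x hx, mul_zero], fun d hd => ?_⟩
        rw [coeff_monomial_mul', coeff_monomial_mul']
        split_ifs with h1 h2 h2
        all_goals try rfl
        all_goals
          obtain ⟨e, rfl⟩ := exists_add_of_le h1
          rw [map_add] at hd h2
          rw [add_tsub_cancel_left, hF' e (by omega)]
        · rw [if_pos (by omega)]
        · rw [if_neg (by omega), mul_zero]
      · refine ⟨0, by simp, fun d hd => ?_⟩
        rw [coeff_monomial_mul', coeff_zero]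
        split_ifs with h1 h2
        · obtain ⟨e, rfl⟩ := exists_add_of_le h2
          rw [map_add] at h1
          omega
        · rfl
        · rfl

theorem mem_topFormIdeal_of_isHomogeneous {Y : Set (Fin n → ℂ)} {f F : MvPolynomial (Fin n) ℂ}
    {D : ℕ} (hf : f.IsHomogeneous D) (hF : ∀ x ∈ Y, eval x F = 0)
    (h : ∀ d : Fin n →₀ ℕ, D ≤ d.degree → coeff d F = coeff d f) : f ∈ topFormIdeal Y := by
  intro E
  by_cases hE : E = D
  · subst hE
    refine ⟨F, hF, fun d hd => ?_⟩
    rw [h d hd]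
    split_ifs with h1
    · rfl
    · exact hf.coeff_eq_zero h1
  · refine ⟨0, by simp, fun d _ => ?_⟩
    split_ifs with h1
    · rw [hf.coeff_eq_zero (by omega), coeff_zero]
    · rfl

/-- Use the homogeneous component of `f` containing its lex-leading monomial: `degLex` compares
total degree first, so the lower-degree terms of the lift `F` do not matter. -/
theorem exists_degLex_degree_eq {Y : Set (Fin n → ℂ)} {f : MvPolynomial (Fin n) ℂ}
    (hf : f ∈ topFormIdeal Y) (h0 : f ≠ 0) :
    ∃ F : MvPolynomial (Fin n) ℂ, (∀ x ∈ Y, eval x F = 0) ∧ F ≠ 0 ∧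
      MonomialOrder.degLex.degree F = MonomialOrder.lex.degree f := by
  set m := MonomialOrder.lex.degree f with hm
  obtain ⟨F, hF, hc⟩ := hf m.degree
  have hmem : m ∈ F.support := by
    rw [mem_support_iff, hc m le_rfl, if_pos rfl, ← mem_support_iff]
    exact MonomialOrder.degree_mem_support h0
  refine ⟨F, hF, fun h => by simp [h] at hmem, ?_⟩
  apply MonomialOrder.degLex.toSyn.injective
  apply le_antisymm
  · rw [MonomialOrder.degree_le_iff]
    intro d hd
    rw [MonomialOrder.degLex_le_iff, Finsupp.DegLex.le_iff]
    simp only [ofDegLex_toDegLex]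
    rcases lt_or_ge d.degree m.degree with hlt | hge
    · exact Or.inl hlt
    · rw [mem_support_iff, hc d hge, ite_ne_right_iff, ← mem_support_iff] at hd
      exact Or.inr ⟨hd.1, MonomialOrder.lex_le_iff.1 (MonomialOrder.le_degree hd.2)⟩
  · exact MonomialOrder.le_degree hmem

theorem not_standard_lex_degree {Y : Set (Fin n → ℂ)} {good : (Fin n →₀ ℕ) → Prop}
    (hind : ∀ F : MvPolynomial (Fin n) ℂ, (∀ x ∈ Y, eval x F = 0) →
      (∀ d ∈ F.support, good d) → F = 0)
    (hcov : ∀ c, ¬ good c → ∃ g ∈ topFormIdeal Y, g ≠ 0 ∧ MonomialOrder.lex.degree g ≤ c)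
    {f : MvPolynomial (Fin n) ℂ} (hf : f ∈ topFormIdeal Y) (h0 : f ≠ 0) :
    ¬ good (MonomialOrder.lex.degree f) := by
  intro hgood
  obtain ⟨F, hF, hF0, hdeg⟩ := exists_degLex_degree_eq hf h0
  rw [← hdeg] at hgood
  let B : Set (MvPolynomial (Fin n) ℂ) := {G | G ≠ 0 ∧ ∀ x ∈ Y, eval x G = 0}
  -- Split off the leading term and reduce the rest by all nonzero polynomials vanishing on `Y`. By
  -- `hcov` the remainder has only good exponents, so leading term plus remainder vanishes on `Y`
  -- with good support, yet is nonzero.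
  obtain ⟨g, R, hR, -, hR'⟩ := MonomialOrder.degLex.div_set (B := B)
    (fun G hG => (MonomialOrder.leadingCoeff_ne_zero_iff.2 hG.1).isUnit)
    (F - MonomialOrder.degLex.leadingTerm F)
  have hlin : ∀ x ∈ Y,
      eval x (Finsupp.linearCombination _ (fun b : B => (b : MvPolynomial (Fin n) ℂ)) g) = 0 := by
    intro x hx
    rw [Finsupp.linearCombination_apply, Finsupp.sum, map_sum]
    refine Finset.sum_eq_zero fun b _ => ?_
    rw [smul_eq_mul, map_mul, b.2.2 x hx, mul_zero]
  have hRm : coeff (MonomialOrder.degLex.degree F) R = 0 := by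
    rw [← notMem_support_iff]
    exact fun hmem => hR' _ hmem F ⟨hF0, hF⟩ le_rfl
  have hzero := hind (MonomialOrder.degLex.leadingTerm F + R) ?_ ?_
  · have := congrArg (coeff (MonomialOrder.degLex.degree F)) hzero
    rw [coeff_add, hRm, MonomialOrder.leadingTerm, coeff_monomial, if_pos rfl, add_zero,
      coeff_zero] at this
    exact MonomialOrder.leadingCoeff_ne_zero_iff.2 hF0 this
  · intro x hx
    have := congrArg (eval x) hR
    rw [map_sub, map_add, hlin x hx, hF x hx] at this
    rw [map_add]
    linear_combination -this
  · intro d hd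
    by_cases hdR : d ∈ R.support
    · by_contra hng
      obtain ⟨g', hg', hg0, hle⟩ := hcov d hng
      obtain ⟨G, hG, hG0, hGdeg⟩ := exists_degLex_degree_eq hg' hg0
      exact hR' d hdR G ⟨hG0, hG⟩ (hGdeg ▸ hle)
    · rw [mem_support_iff, coeff_add, notMem_support_iff.1 hdR, add_zero,
        MonomialOrder.leadingTerm, coeff_monomial, ite_ne_right_iff] at hd
      rwa [← hd.1]

/-- The points with coordinates in `V` whose `r`-th powers cover `A`. -/
def coverPoints (n : ℕ) (A V : Finset ℂ) (r : ℕ) : Set (Fin n → ℂ) :=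
  {x | (∀ i, x i ∈ V) ∧ ∀ a ∈ A, ∃ i, x i ^ r = a}

theorem X_pow_mem_topFormIdeal (A V : Finset ℂ) (r : ℕ) (i : Fin n) :
    X i ^ V.card ∈ topFormIdeal (coverPoints n A V r) := by
  let p : Polynomial ℂ := ∏ v ∈ V, (Polynomial.X - Polynomial.C v)
  have hp : p.Monic := Polynomial.monic_prod_of_monic _ _ fun v _ => Polynomial.monic_X_sub_C v
  have hdeg : p.natDegree = V.card := Polynomial.natDegree_finsetProd_X_sub_C_eq_card V id
  refine mem_topFormIdeal_of_isHomogeneous (D := V.card)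
    (F := Polynomial.aeval (X i : MvPolynomial (Fin n) ℂ) p)
    (by simpa using (isHomogeneous_X ℂ i).pow V.card) ?_ ?_
  · intro x hx
    simp only [p, map_prod, map_sub, Polynomial.aeval_X, Polynomial.aeval_C, eval_X]
    refine Finset.prod_eq_zero (hx.1 i) ?_
    simp [algebraMap_eq]
  · intro d hd
    rw [hp.as_sum, hdeg]
    simp only [map_add, map_pow, map_sum, map_mul, Polynomial.aeval_X, Polynomial.aeval_C,
      coeff_add, coeff_sum]
    rw [Finset.sum_eq_zero, add_zero]
    intro e he
    rw [algebraMap_eq, coeff_C_mul, X_pow_eq_monomial, coeff_monomial, if_neg, mul_zero]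
    rintro rfl
    rw [Finsupp.degree_single] at hd
    rw [Finset.mem_range] at he
    omega

theorem esymmPow_eq (n r d : ℕ) :
    esymmPow n r d = ∑ t ∈ Finset.univ.powersetCard d, ∏ i ∈ t, (X i : MvPolynomial (Fin n) ℂ) ^ r := by
  rw [esymmPow, esymm, map_sum]
  refine Finset.sum_congr rfl fun t _ => ?_
  rw [map_prod]
  exact Finset.prod_congr rfl fun i _ => by rw [aeval_X]

theorem isHomogeneous_esymmPow (n r d : ℕ) : (esymmPow n r d).IsHomogeneous (r * d) := by
  rw [esymmPow_eq]
  refine IsHomogeneous.sum _ _ _ fun t ht => ?_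
  rw [Finset.mem_powersetCard] at ht
  have := IsHomogeneous.prod t (fun i => (X i : MvPolynomial (Fin n) ℂ) ^ r) (fun _ => r)
    fun i _ => by simpa using (isHomogeneous_X ℂ i).pow r
  rwa [Finset.sum_const, smul_eq_mul, ht.2, mul_comm] at this

/-- Take the coefficient of `t^d` in `∏ (1 - x_i^r t) / ∏_{a ∈ A} (1 - a t)`. On `Y` the denominator
cancels, leaving a polynomial of degree `n - |A| < d` in `t`; the other contributions to the
coefficient are constants times `e_p` with `p < d`, of lower degree in `x`. -/
theorem esymmPow_mem_topFormIdeal (A V : Finset ℂ) {r : ℕ} (hr : 0 < r) {d : ℕ}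
    (hd : n < d + A.card) : esymmPow n r d ∈ topFormIdeal (coverPoints n A V r) := by
  classical
  let L : PowerSeries (MvPolynomial (Fin n) ℂ) := ∏ i : Fin n, linSeries (X i ^ r)
  let H : PowerSeries (MvPolynomial (Fin n) ℂ) := ∏ a ∈ A, geomSeries (C a)
  have hL : ∀ c, PowerSeries.coeff c L = (-1) ^ c * esymmPow n r c := fun c => by
    rw [coeff_prod_linSeries, esymmPow_eq]
  have hH : H = PowerSeries.map C (∏ a ∈ A, geomSeries a) := by
    rw [map_prod]; exact Finset.prod_congr rfl fun a _ => (map_geomSeries _ _).symm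
  refine mem_topFormIdeal_of_isHomogeneous (isHomogeneous_esymmPow n r d)
    (F := (-1) ^ d * PowerSeries.coeff d (L * H)) ?_ ?_
  · intro x hx
    have hmap : PowerSeries.map (eval x) (L * H)
        = (∏ i, linSeries (x i ^ r)) * ∏ a ∈ A, geomSeries a := by
      rw [map_mul, map_prod, map_prod]
      congr 1
      · exact Finset.prod_congr rfl fun i _ => by rw [map_linSeries]; simp
      · exact Finset.prod_congr rfl fun a _ => by rw [map_geomSeries]; simp
    rw [map_mul, ← PowerSeries.coeff_map, hmap]
    choose g hg using hx.2
    have hinj : Function.Injective fun a : {a // a ∈ A} => g a.1 a.2 := by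
      intro a b hab
      apply Subtype.ext
      rw [← hg a a.2, ← hg b b.2]
      simp only at hab
      rw [hab]
    let T : Finset (Fin n) := A.attach.image fun a : {a // a ∈ A} => g a.1 a.2
    have hT : ∏ i ∈ T, linSeries (x i ^ r) = ∏ a ∈ A, linSeries a := by
      rw [Finset.prod_image fun a _ b _ h => hinj h, ← Finset.prod_attach A]
      exact Finset.prod_congr rfl fun a _ => by rw [hg]
    have hTc : T.card = A.card := by
      rw [Finset.card_image_of_injective _ hinj, Finset.card_attach]
    have h1 := prod_linSeries_mul_prod_geomSeries A fun a : ℂ => a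
    rw [← Finset.prod_sdiff (Finset.subset_univ T), hT, mul_assoc, h1, mul_one,
      coeff_prod_linSeries_of_card_lt, mul_zero]
    have hTn : T.card ≤ n := by simpa using Finset.card_le_univ T
    rw [Finset.card_sdiff_of_subset (Finset.subset_univ _), hTc, Finset.card_univ,
      Fintype.card_fin]
    omega
  · intro m hm
    have hone : ((-1) ^ d * (-1) ^ d : MvPolynomial (Fin n) ℂ) = 1 := by
      rw [← mul_pow]; simp
    rw [PowerSeries.coeff_mul, Finset.mul_sum, coeff_sum, Finset.sum_eq_single (d, 0)]
    · simp only [hL]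
      rw [hH, PowerSeries.coeff_map]
      simp only [geomSeries, PowerSeries.coeff_zero_eq_constantCoeff, map_prod]
      rw [← mul_assoc, ← mul_assoc, hone]
      simp
    · rintro ⟨p, q⟩ hpq hne
      rw [Finset.HasAntidiagonal.mem_antidiagonal] at hpq
      simp only at hpq
      have hpd : p < d := by
        rcases Nat.eq_zero_or_pos q with h | h
        · subst h; exact absurd (by rw [← hpq]; rfl) hne
        · omega
      have hlt : r * p < m.degree := lt_of_lt_of_le (Nat.mul_lt_mul_of_pos_left hpd hr) hm
      have e : ((-1) ^ d * (PowerSeries.coeff p L * PowerSeries.coeff q H)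
          : MvPolynomial (Fin n) ℂ) = C ((-1) ^ (d + p)
            * PowerSeries.coeff q (∏ a ∈ A, geomSeries a)) * esymmPow n r p := by
        rw [hL, hH, PowerSeries.coeff_map]
        simp only [map_mul, map_pow, map_neg, map_one, pow_add]
        ring
      simp only
      rw [e, coeff_C_mul, (isHomogeneous_esymmPow n r p).coeff_eq_zero hlt.ne', mul_zero]
    · intro h
      exact absurd (Finset.HasAntidiagonal.mem_antidiagonal.2 (add_zero d)) h

end TopForms

/-! ### A suitable alphabet -/

section Alphabet

-- `A = {1, …, k}`; each element has `r` distinct roots, and distinct elements have disjoint root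
-- sets. For `e = 1` the point 0 is added.
open scoped Classical in
theorem exists_alphabet (k : ℕ) {r e : ℕ} (hr : 0 < r) (he : e ≤ 1) :
    ∃ A V : Finset ℂ, A.card = k ∧ V.card = k * r + e ∧
      ∀ B ⊆ A, B.card * r ≤ (V.filter fun v => v ^ r ∈ B).card := by
  let A : Finset ℂ := (Finset.range k).image fun j : ℕ => (j : ℂ) + 1
  have hA0 : ∀ a ∈ A, a ≠ 0 := by
    intro a ha
    obtain ⟨j, -, rfl⟩ := Finset.mem_image.1 ha
    exact Nat.cast_add_one_ne_zero j
  let ρ : ℂ → Finset ℂ := fun a => (Polynomial.nthRoots r a).toFinset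
  have hρ : ∀ a v, v ∈ ρ a ↔ v ^ r = a := fun a v => by
    rw [Multiset.mem_toFinset, Polynomial.mem_nthRoots hr]
  have hroot := Complex.isPrimitiveRoot_exp r hr.ne'
  have hcard : ∀ a ∈ A, (ρ a).card = r := by
    intro a ha
    rw [Multiset.toFinset_card_of_nodup (hroot.nthRoots_nodup (hA0 a ha)), hroot.card_nthRoots,
      if_pos (IsAlgClosed.exists_pow_nat_eq a hr)]
  have hB : ∀ B ⊆ A, (B.biUnion ρ).card = B.card * r := by
    intro B hBA
    rw [Finset.card_biUnion, Finset.sum_const_nat fun a ha => hcard a (hBA ha)]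
    intro a _ b _ hab
    rw [Function.onFun, Finset.disjoint_left]
    intro v hv hv'
    exact hab (((hρ a v).1 hv).symm.trans ((hρ b v).1 hv'))
  let E : Finset ℂ := if e = 0 then ∅ else {0}
  have hE : E.card = e := by
    simp only [E]; split_ifs
    · simp [*]
    · rw [Finset.card_singleton]; omega
  have hAc : A.card = k := by
    rw [Finset.card_image_of_injective, Finset.card_range]
    intro a b hab
    simpa using hab
  refine ⟨A, A.biUnion ρ ∪ E, hAc, ?_, ?_⟩
  · rw [Finset.card_union_of_disjoint, hB A subset_rfl, hE, hAc]
    rw [Finset.disjoint_left]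
    intro v hv hvE
    have hv0 : v = 0 := by
      simp only [E] at hvE
      split_ifs at hvE
      · simp at hvE
      · simpa using hvE
    obtain ⟨a, ha, hva⟩ := Finset.mem_biUnion.1 hv
    rw [hρ, hv0, zero_pow hr.ne'] at hva
    exact hA0 a ha hva.symm
  · intro B hBA
    rw [← hB B hBA]
    refine Finset.card_le_card fun v hv => ?_
    obtain ⟨a, ha, hva⟩ := Finset.mem_biUnion.1 hv
    refine Finset.mem_filter.2 ⟨Finset.mem_union_left _ (Finset.mem_biUnion.2 ⟨a, hBA ha, hva⟩), ?_⟩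
    rwa [(hρ a v).1 hva]

end Alphabet
/-! ### Skip compositions -/

section Skip

variable {n : ℕ}

theorem card_filter_lt_le (S : Finset (Fin n)) (i : Fin n) : (S.filter (· < i)).card ≤ i := by
  rw [← Fin.card_Iio i]
  exact Finset.card_le_card fun j hj => Finset.mem_Iio.2 (Finset.mem_filter.1 hj).2

theorem skipComposition_of_mem {S : Finset (Fin n)} {i : Fin n} (hi : i ∈ S) :
    skipComposition S i = (i : ℕ) + 1 - (S.filter (· < i)).card := if_pos hi

theorem skipComposition_of_notMem {S : Finset (Fin n)} {i : Fin n} (hi : i ∉ S) :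
    skipComposition S i = 0 := if_neg hi

theorem skipComposition_pos {S : Finset (Fin n)} {i : Fin n} (hi : i ∈ S) :
    0 < skipComposition S i := by
  have := card_filter_lt_le S i
  rw [skipComposition_of_mem hi]
  omega

theorem card_filter_lt_le_add (S : Finset (Fin n)) {i j : Fin n} (hij : i ≤ j) :
    (S.filter (· < j)).card + i ≤ (S.filter (· < i)).card + j := by
  have h1 : S.filter (· < j) ⊆ S.filter (· < i) ∪ Finset.Ico i j := by
    intro l hl
    simp only [Finset.mem_filter, Finset.mem_union, Finset.mem_Ico] at hl ⊢
    rcases lt_or_ge l i with h | h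
    · exact Or.inl ⟨hl.1, h⟩
    · exact Or.inr ⟨h, hl.2⟩
  have h2 := (Finset.card_le_card h1).trans (Finset.card_union_le _ _)
  rw [Fin.card_Ico] at h2
  rw [Fin.le_def] at hij
  omega

theorem skipComposition_mono {S : Finset (Fin n)} {i j : Fin n} (hij : i ≤ j)
    (hj : j ∈ S) : skipComposition S i ≤ skipComposition S j := by
  by_cases hi : i ∈ S
  · have := card_filter_lt_le_add S hij
    rw [skipComposition_of_mem hi, skipComposition_of_mem hj]
    omega
  · rw [skipComposition_of_notMem hi]
    exact Nat.zero_le _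

theorem skipComposition_add_card_le {S : Finset (Fin n)} {i : Fin n} (hi : i ∈ S) {N : ℕ}
    (hN : ∀ j ∈ S, (j : ℕ) < N) : skipComposition S i + S.card ≤ N + 1 := by
  have h1 : S ⊆ S.filter (· < i) ∪ (S.filter (i ≤ ·)) := by
    intro l hl
    simp only [Finset.mem_filter, Finset.mem_union]
    rcases lt_or_ge l i with h | h
    · exact Or.inl ⟨hl, h⟩
    · exact Or.inr ⟨hl, h⟩
  have h2 : (S.filter (i ≤ ·)).card ≤ N - i := by
    rw [← Nat.card_Ico, ← Finset.card_map Fin.valEmbedding]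
    refine Finset.card_le_card fun l hl => ?_
    simp only [Finset.mem_map, Finset.mem_filter, Fin.valEmbedding_apply] at hl
    obtain ⟨j, ⟨hj, hij⟩, rfl⟩ := hl
    exact Finset.mem_Ico.2 ⟨hij, hN j hj⟩
  have h3 := (Finset.card_le_card h1).trans (Finset.card_union_le _ _)
  have h4 := hN i hi
  rw [skipComposition_of_mem hi]
  have := card_filter_lt_le S i
  omega

theorem nonzeroAntitone_skipComposition (S : Finset (Fin n)) :
    NonzeroAntitone fun i => skipComposition S i.rev := by
  intro p q hpq hp
  refine skipComposition_mono (Fin.rev_le_rev.2 hpq.le) ?_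
  by_contra h
  exact hp (skipComposition_of_notMem h)

/-- An exponent which is not standard is bounded below by a multiple of a skip composition. -/
theorem exists_finset_of_not_isStandard (k r : ℕ) (n u : ℕ) (hu : u ≤ k) (d : Fin n → ℕ)
    (h : ¬ IsStandard k r n u d) : ∃ S : Finset (Fin n), S.card = n + 1 - u ∧
      ∀ i ∈ S, ((i : ℕ) + 1 - (S.filter (· < i)).card + (k - u)) * r ≤ d i := by
  induction n generalizing u with
  | zero =>
    replace h : u ≠ 0 := h
    exact ⟨∅, by rw [Finset.card_empty]; omega, by simp⟩
  | succ n ih =>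
    -- Once the required cardinality is 0, stop: this gives exactly `n + 1 - u` positions even if
    -- more entries reach their thresholds.
    by_cases hun : n + 2 ≤ u
    · exact ⟨∅, by rw [Finset.card_empty]; omega, by simp⟩
    have hfilter : ∀ (S : Finset (Fin n)) (i : Fin n),
        ((S.map (Fin.succEmb n)).filter (· < i.succ)).card = (S.filter (· < i)).card := by
      intro S i
      rw [Finset.filter_map, Finset.card_map]
      refine congrArg Finset.card (Finset.filter_congr fun l _ => ?_)
      simp [Fin.succ_lt_succ_iff]
    rw [IsStandard, not_and_or, Classical.not_imp, Classical.not_imp] at h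
    rcases h with ⟨hle, h⟩ | ⟨-, h⟩
    · obtain ⟨S, hS, hS'⟩ := ih u hu _ h
      have h0 : (0 : Fin (n + 1)) ∉ S.map (Fin.succEmb n) := by simp
      refine ⟨insert 0 (S.map (Fin.succEmb n)), ?_, ?_⟩
      · rw [Finset.card_insert_of_notMem h0, Finset.card_map]
        omega
      · intro i hi
        rcases Finset.mem_insert.1 hi with rfl | hi
        · refine le_trans (Nat.mul_le_mul_right _ ?_) hle
          simp only [Fin.val_zero]
          omega
        · obtain ⟨j, hj, rfl⟩ := Finset.mem_map.1 hi
          refine le_trans (Nat.mul_le_mul_right _ ?_) (hS' j hj)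
          rw [Fin.coe_succEmb, Finset.filter_insert, if_pos (Fin.succ_pos j),
            Finset.card_insert_of_notMem (by simp), hfilter, Fin.val_succ]
          omega
    · obtain ⟨S, hS, hS'⟩ := ih (u - 1) (by omega) _ h
      have hc : S.card ≤ n := by simpa using Finset.card_le_univ S
      refine ⟨S.map (Fin.succEmb n), by rw [Finset.card_map]; omega, ?_⟩
      intro i hi
      obtain ⟨j, hj, rfl⟩ := Finset.mem_map.1 hi
      refine le_trans (Nat.mul_le_mul_right _ ?_) (hS' j hj)
      rw [Fin.coe_succEmb, hfilter, Fin.val_succ]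
      have := card_filter_lt_le S j
      omega

/-- Look at the first position `p` where `S` and `T` differ. If `p ∈ S`, the prefix sum up to `p` is
too large for `T`. If `p ∈ T`, the next element `q` of `S` has skipped `p`, so its part exceeds
every part of `T` at positions up to `q`. -/
theorem not_skipComposition_le {S T : Finset (Fin n)} (hcard : S.card = T.card) (hne : S ≠ T)
    {d : Fin n → ℕ} (hsum : ∀ i, ∑ p ∈ Finset.Iic i, d p ≤ ∑ p ∈ Finset.Iic i, skipComposition T p)
    (hmax : ∀ i, ∃ p, p ≤ i ∧ d i ≤ skipComposition T p) :
    ¬ ∀ i, skipComposition S i ≤ d i := by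
  intro hle
  obtain ⟨p, hp, hmin⟩ : ∃ p, ¬ (p ∈ S ↔ p ∈ T) ∧ ∀ l, l < p → (l ∈ S ↔ l ∈ T) := by
    obtain ⟨p, hp, hp'⟩ := WellFounded.has_min (wellFounded_lt (α := Fin n))
      {p | ¬ (p ∈ S ↔ p ∈ T)} (by
        by_contra h
        rw [Set.not_nonempty_iff_eq_empty, Set.eq_empty_iff_forall_notMem] at h
        exact hne (Finset.ext fun l => not_not.1 (h l)))
    exact ⟨p, hp, fun l hl => by by_contra h; exact hp' l h hl⟩
  have hfil : ∀ l, l ≤ p → S.filter (· < l) = T.filter (· < l) := by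
    intro l hl
    ext i
    simp only [Finset.mem_filter]
    constructor <;> rintro ⟨h1, h2⟩
    · exact ⟨(hmin i (h2.trans_le hl)).1 h1, h2⟩
    · exact ⟨(hmin i (h2.trans_le hl)).2 h1, h2⟩
  by_cases hpS : p ∈ S
  · have hpT : p ∉ T := fun h => hp ⟨fun _ => h, fun _ => hpS⟩
    have e : Finset.Iic p = insert p (Finset.Iio p) := by
      ext l; simp only [Finset.mem_Iic, Finset.mem_insert, Finset.mem_Iio, le_iff_eq_or_lt]
    have h1 := (Finset.sum_le_sum fun i (_ : i ∈ Finset.Iic p) => hle i).trans (hsum p)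
    rw [e, Finset.sum_insert (by simp), Finset.sum_insert (by simp),
      skipComposition_of_notMem hpT] at h1
    have h2 : ∑ i ∈ Finset.Iio p, skipComposition S i
        = ∑ i ∈ Finset.Iio p, skipComposition T i := by
      refine Finset.sum_congr rfl fun i hi => ?_
      rw [Finset.mem_Iio] at hi
      simp only [skipComposition, hmin i hi, hfil i hi.le]
    have := skipComposition_pos hpS
    omega
  · have hpT : p ∈ T := by by_contra h; exact hp ⟨fun h' => absurd h' hpS, fun h' => absurd h' h⟩
    have hex : ∃ q ∈ S, p < q := by
      by_contra! hno
      have hsub : S ⊆ T.filter (· < p) := by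
        rw [← hfil p le_rfl]
        intro l hl
        exact Finset.mem_filter.2 ⟨hl, lt_of_le_of_ne (hno l hl) fun h => hpS (h ▸ hl)⟩
      have hss : T.filter (· < p) ⊂ T :=
        ⟨Finset.filter_subset _ _, fun h => by simpa using h hpT⟩
      have := (Finset.card_le_card hsub).trans_lt (Finset.card_lt_card hss)
      omega
    obtain ⟨q, ⟨hqS, hpq⟩, hqmin⟩ := WellFounded.has_min (wellFounded_lt (α := Fin n))
      {q | q ∈ S ∧ p < q} hex
    have hSq : S.filter (· < q) = T.filter (· < p) := by
      rw [← hfil p le_rfl]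
      ext l
      simp only [Finset.mem_filter]
      constructor
      · rintro ⟨h1, h2⟩
        refine ⟨h1, ?_⟩
        by_contra h3
        exact hqmin l ⟨h1, lt_of_le_of_ne (not_lt.1 h3) fun h => hpS (h ▸ h1)⟩ h2
      · exact fun ⟨h1, h2⟩ => ⟨h1, h2.trans hpq⟩
    obtain ⟨l, hlq, hl⟩ := hmax q
    have h1 := (hle q).trans hl
    have hcp := card_filter_lt_le T p
    have hlT : l ∈ T := by
      by_contra h
      rw [skipComposition_of_notMem h] at h1
      have := skipComposition_pos hqS
      omega
    rw [skipComposition_of_mem hqS, hSq, skipComposition_of_mem hlT] at h1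
    rw [Fin.lt_def] at hpq
    rw [Fin.le_def] at hlq
    rcases le_or_gt l p with h | h
    · have h2 := card_filter_lt_le_add T h
      rw [Fin.le_def] at h
      have := card_filter_lt_le T l
      omega
    · have h2 : T.filter (· < p) ⊂ T.filter (· < l) := by
        refine ⟨fun i hi => ?_, fun hsub => ?_⟩
        · rw [Finset.mem_filter] at hi ⊢
          exact ⟨hi.1, hi.2.trans h⟩
        · have := hsub (Finset.mem_filter.2 ⟨hpT, h⟩)
          simp at this
      have := Finset.card_lt_card h2
      have := card_filter_lt_le T l
      omega

end Skip

/-! ### The polynomials of the basis -/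

section SkipDemazure

variable {n : ℕ}

theorem reversePow_eq_expand (r : ℕ) (f : MvPolynomial (Fin n) ℂ) :
    reversePow r f = expand r (rename Fin.revPerm f) := by
  have : (aeval fun i : Fin n => (X i.rev : MvPolynomial (Fin n) ℂ) ^ r)
      = (expand r).comp (rename Fin.revPerm) := by
    apply algHom_ext
    intro i
    simp
  rw [reversePow, this, AlgHom.comp_apply]

theorem reversePow_esymm (r d : ℕ) : reversePow r (esymm (Fin n) ℂ d) = esymmPow n r d := by
  rw [reversePow_eq_expand, rename_esymm, esymmPow]
  rfl

/-- The exponent `r γ(S)`. -/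
def skipExponent (r : ℕ) (S : Finset (Fin n)) : Fin n →₀ ℕ :=
  Finsupp.equivFunOnFinite.symm fun i => r * skipComposition S i

theorem coeff_skipDemazure {r : ℕ} (hr : r ≠ 0) (S : Finset (Fin n)) :
    coeff (skipExponent r S) (skipDemazure r S) = 1 := by
  have e : skipExponent r S = r • Finsupp.mapDomain Fin.revPerm
      (Finsupp.equivFunOnFinite.symm fun i => skipComposition S i.rev) := by
    ext i
    simp [skipExponent, Finsupp.mapDomain_equiv_apply]
  rw [skipDemazure, reversePow_eq_expand, e, coeff_expand_smul r hr,
    coeff_rename_mapDomain _ Fin.revPerm.injective,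
    coeff_demazureChar_self (nonzeroAntitone_skipComposition S)]

theorem exists_of_mem_support_skipDemazure {r : ℕ} (S : Finset (Fin n))
    {d : Fin n →₀ ℕ} (hd : d ∈ (skipDemazure r S).support) :
    ∃ e : Fin n → ℕ, (∀ i, d i = r * e i) ∧
      (∀ i, ∑ p ∈ Finset.Iic i, e p ≤ ∑ p ∈ Finset.Iic i, skipComposition S p) ∧
      ∀ i, ∃ p, p ≤ i ∧ e i ≤ skipComposition S p := by
  classical
  rw [skipDemazure, reversePow_eq_expand] at hd
  obtain ⟨d1, hd1, rfl⟩ := Finset.mem_image.1 (support_expand_subset _ hd)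
  rw [support_rename_of_injective Fin.revPerm.injective] at hd1
  obtain ⟨d2, hd2, rfl⟩ := Finset.mem_image.1 hd1
  have hγ := nonzeroAntitone_skipComposition S
  have hrev : ∀ (i : Fin n) (f : Fin n → ℕ),
      ∑ p ∈ Finset.Iic i, f p.rev = ∑ p ∈ Finset.Ici i.rev, f p := by
    intro i f
    refine Finset.sum_bij' (fun p _ => p.rev) (fun p _ => p.rev) ?_ ?_ ?_ ?_ ?_
    · simp
    · intro p hp
      rw [Finset.mem_Ici] at hp
      rw [Finset.mem_Iic, ← Fin.rev_le_rev, Fin.rev_rev]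
      exact hp
    · simp
    · simp
    · simp
  refine ⟨fun i => d2 i.rev, fun i => ?_, fun i => ?_, fun i => ?_⟩
  · simp [Finsupp.mapDomain_equiv_apply]
  · rw [hrev i d2]
    refine (sum_le_of_mem_support_demazureChar hγ d2 hd2 i.rev).trans_eq ?_
    rw [← hrev i fun p => skipComposition S p.rev]
    simp
  · obtain ⟨p, hp, hp'⟩ := exists_le_of_mem_support_demazureChar hγ d2 hd2 i.rev
    exact ⟨p.rev, by rw [← Fin.rev_le_rev, Fin.rev_rev]; exact hp, hp'⟩

theorem toLex_le_of_sum_le {d e : Fin n →₀ ℕ}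
    (h : ∀ i, ∑ p ∈ Finset.Iic i, d p ≤ ∑ p ∈ Finset.Iic i, e p) : toLex d ≤ toLex e := by
  by_contra hlt
  rw [not_le, Finsupp.Lex.lt_iff] at hlt
  obtain ⟨i, hi, hi'⟩ := hlt
  have e1 : Finset.Iic i = insert i (Finset.Iio i) := by
    ext l; simp only [Finset.mem_Iic, Finset.mem_insert, Finset.mem_Iio, le_iff_eq_or_lt]
  have h1 := h i
  rw [e1, Finset.sum_insert (by simp), Finset.sum_insert (by simp),
    Finset.sum_congr rfl fun p hp => show d p = e p from (hi p (Finset.mem_Iio.1 hp)).symm] at h1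
  replace hi' : e i < d i := hi'
  exact absurd (Nat.le_of_add_le_add_right h1) (not_le.2 hi')

theorem degree_skipDemazure {r : ℕ} (hr : r ≠ 0) (S : Finset (Fin n)) :
    MonomialOrder.lex.degree (skipDemazure r S) = skipExponent r S := by
  apply MonomialOrder.lex.toSyn.injective
  apply le_antisymm
  · rw [MonomialOrder.degree_le_iff]
    intro d hd
    rw [MonomialOrder.lex_le_iff]
    apply toLex_le_of_sum_le
    intro i
    obtain ⟨e, he, hsum, -⟩ := exists_of_mem_support_skipDemazure S hd
    simp only [he, skipExponent, Finsupp.equivFunOnFinite_symm_apply_apply, ← Finset.mul_sum]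
    exact Nat.mul_le_mul_left _ (hsum i)
  · apply MonomialOrder.le_degree
    rw [mem_support_iff, coeff_skipDemazure hr]
    exact one_ne_zero

theorem leadingCoeff_skipDemazure {r : ℕ} (hr : r ≠ 0) (S : Finset (Fin n)) :
    MonomialOrder.lex.leadingCoeff (skipDemazure r S) = 1 := by
  rw [MonomialOrder.leadingCoeff, degree_skipDemazure hr, coeff_skipDemazure hr]

theorem skipDemazure_mem (r : ℕ) {S : Finset (Fin n)} (hS : S.Nonempty)
    (I : Ideal (MvPolynomial (Fin n) ℂ)) (hI : ∀ d, S.card ≤ d → d ≤ n → esymmPow n r d ∈ I) :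
    skipDemazure r S ∈ I := by
  classical
  set m := S.card with hm
  let T : Finset (Fin n) := S.map Fin.revPerm.toEmbedding
  have hT : T.card = m := Finset.card_map _
  have hTS : ∀ p, p ∈ T ↔ p.rev ∈ S := by
    intro p
    simp only [T, Finset.mem_map, Equiv.coe_toEmbedding, Fin.revPerm_apply]
    constructor
    · rintro ⟨a, ha, rfl⟩; rwa [Fin.rev_rev]
    · exact fun h => ⟨_, h, Fin.rev_rev p⟩
  let b := T.orderEmbOfFin hT
  have hbT : ∀ j, (b j).rev ∈ S := fun j => (hTS _).1 (T.orderEmbOfFin_mem hT j)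
  have hbex : ∀ p, p.rev ∈ S → ∃ j, b j = p := by
    intro p hp
    have := (hTS p).2 hp
    rw [← Finset.mem_coe, ← T.range_orderEmbOfFin hT] at this
    exact this
  let lam : Fin m → ℕ := fun j => skipComposition S (b j).rev
  have hplace : (fun i : Fin n => skipComposition S i.rev) = placeParts b lam := by
    funext p
    by_cases hp : p.rev ∈ S
    · obtain ⟨j, rfl⟩ := hbex p hp
      rw [placeParts_apply b.injective]
    · rw [skipComposition_of_notMem hp, placeParts_eq_zero]
      rintro j rfl
      exact hp (hbT j)
  -- Exactly the `m - 1 - j` later positions reverse to elements of `S` smaller than `(b j).rev`;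
  -- the skip composition meets the bound with equality.
  have hlam : ∀ j : Fin m, n + j ≤ lam j + (m - 1) + b j := by
    intro j
    have h1 : (S.filter (· < (b j).rev)).card ≤ m - 1 - j := by
      rw [← Fin.card_Ioi j, ← Finset.card_image_of_injective (Finset.Ioi j)
        (Fin.rev_injective.comp b.injective)]
      refine Finset.card_le_card fun s hs => ?_
      rw [Finset.mem_filter] at hs
      obtain ⟨l, hl⟩ := hbex s.rev (by rw [Fin.rev_rev]; exact hs.1)
      refine Finset.mem_image.2 ⟨l, ?_, by simp [hl]⟩
      rw [Finset.mem_Ioi, ← b.lt_iff_lt, hl, ← Fin.rev_lt_rev, Fin.rev_rev]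
      exact hs.2
    have h2 : lam j = _ := skipComposition_of_mem (hbT j)
    have h3 := card_filter_lt_le S (b j).rev
    have h4 := (b j).isLt
    rw [Fin.val_rev] at h2 h3
    rw [h2]
    omega
  have hmem : demazureChar (fun i : Fin n => skipComposition S i.rev) ∈
      I.comap (aeval fun i : Fin n => (X i.rev : MvPolynomial (Fin n) ℂ) ^ r) := by
    rw [hplace, demazureChar_placeParts b b.strictMono lam ?_ fun j => skipComposition_pos (hbT j)]
    · refine det_jacobiTrudi_mem b lam hlam (Finset.card_pos.2 hS) _ fun d h1 h2 => ?_
      rw [Ideal.mem_comap]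
      have h3 := hI d h1 h2
      rwa [← reversePow_esymm] at h3
    · intro i j hij
      exact skipComposition_mono (Fin.rev_le_rev.2 (b.monotone hij)) (hbT i)
  exact hmem

end SkipDemazure

/-! ### The Gröbner bases -/

section Main

variable {n : ℕ}

theorem isGroebnerBasis_of_forall_degree_le {I : Ideal (MvPolynomial (Fin n) ℂ)}
    {B : Set (MvPolynomial (Fin n) ℂ)} (hfin : B.Finite) (hBI : ∀ g ∈ B, g ∈ I)
    (hlc : ∀ g ∈ B, MonomialOrder.lex.leadingCoeff g = 1)
    (hle : ∀ f ∈ I, f ≠ 0 → ∃ g ∈ B, MonomialOrder.lex.degree g ≤ MonomialOrder.lex.degree f) :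
    IsGroebnerBasis MonomialOrder.lex B I := by
  have h0 : ∀ g ∈ B, g ≠ 0 := fun g hg h => by
    have := hlc g hg
    rw [h, MonomialOrder.leadingCoeff_zero] at this
    exact zero_ne_one this
  refine ⟨hfin, fun g hg => ⟨hBI g hg, h0 g hg⟩, le_antisymm ?_ ?_⟩
  · refine Ideal.span_le.2 ?_
    rintro t ⟨f, hf, hf0, rfl⟩
    obtain ⟨g, hg, hgf⟩ := hle f hf hf0
    obtain ⟨c, hc⟩ := exists_add_of_le hgf
    have e : MonomialOrder.lex.leadingTerm f
        = monomial c (MonomialOrder.lex.leadingCoeff f) * MonomialOrder.lex.leadingTerm g := by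
      rw [MonomialOrder.leadingTerm, MonomialOrder.leadingTerm, hlc g hg, monomial_mul, hc,
        mul_one, add_comm]
    rw [e]
    exact Ideal.mul_mem_left _ _ (Ideal.subset_span ⟨g, hg, rfl⟩)
  · refine Ideal.span_mono ?_
    rintro t ⟨g, hg, rfl⟩
    exact ⟨g, hBI g hg, h0 g hg, rfl⟩

theorem degree_X_pow (i : Fin n) (a : ℕ) :
    MonomialOrder.lex.degree (X i ^ a : MvPolynomial (Fin n) ℂ) = Finsupp.single i a := by
  rw [X_pow_eq_monomial, MonomialOrder.degree_monomial, if_neg one_ne_zero]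

theorem leadingCoeff_X_pow (i : Fin n) (a : ℕ) :
    MonomialOrder.lex.leadingCoeff (X i ^ a : MvPolynomial (Fin n) ℂ) = 1 := by
  rw [X_pow_eq_monomial, MonomialOrder.leadingCoeff_monomial]

/-- The ideal generated by the powers `x_i^a` and the top `k` elementary symmetric polynomials
in `x_1^r, …, x_n^r`. -/
def powerIdeal (n k r a : ℕ) : Ideal (MvPolynomial (Fin n) ℂ) :=
  Ideal.span ({f | ∃ i, f = X i ^ a} ∪ {f | ∃ d, n - k + 1 ≤ d ∧ d ≤ n ∧ f = esymmPow n r d})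

/-- The powers `x_i^a` together with the skip Demazure characters of the sets with property `Q`. -/
def powerBasis (n k r a : ℕ) (Q : Finset (Fin n) → Prop) : Set (MvPolynomial (Fin n) ℂ) :=
  {f | ∃ i, f = X i ^ a} ∪
    {f | ∃ S : Finset (Fin n), Q S ∧ S.card = n - k + 1 ∧ f = skipDemazure r S}

theorem leadingCoeff_of_mem_powerBasis {k r a : ℕ} (hr : r ≠ 0) {Q : Finset (Fin n) → Prop}
    {g : MvPolynomial (Fin n) ℂ} (hg : g ∈ powerBasis n k r a Q) :
    MonomialOrder.lex.leadingCoeff g = 1 := by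
  rcases hg with ⟨i, rfl⟩ | ⟨S, -, -, rfl⟩
  · exact leadingCoeff_X_pow i a
  · exact leadingCoeff_skipDemazure hr S

/-- `hQ` asks `Q` only for sets whose leading monomial is divisible by no `x_i^a`; the others are
not needed to cover the exponents that are not good. -/
theorem isGroebnerBasis_powerBasis {k r e : ℕ} (hkn : k ≤ n) (hr : 0 < r) (he : e ≤ 1)
    {Q : Finset (Fin n) → Prop}
    (hQ : ∀ S : Finset (Fin n), S.card = n - k + 1 →
      (∀ i, r * skipComposition S i < k * r + e) → Q S) :
    IsGroebnerBasis MonomialOrder.lex (powerBasis n k r (k * r + e) Q)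
      (powerIdeal n k r (k * r + e)) := by
  classical
  set a := k * r + e with ha
  have hlc : ∀ g ∈ powerBasis n k r a Q, MonomialOrder.lex.leadingCoeff g = 1 :=
    fun g hg => leadingCoeff_of_mem_powerBasis hr.ne' hg
  have hBI : ∀ g ∈ powerBasis n k r a Q, g ∈ powerIdeal n k r a := by
    rintro g (⟨i, rfl⟩ | ⟨S, -, hS, rfl⟩)
    · exact Ideal.subset_span (Or.inl ⟨i, rfl⟩)
    · refine skipDemazure_mem r (Finset.card_pos.1 (by omega)) _ fun d h1 h2 => ?_
      exact Ideal.subset_span (Or.inr ⟨d, hS ▸ h1, h2, rfl⟩)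
  have hfin : (powerBasis n k r a Q).Finite := by
    refine Set.Finite.union ?_ ?_
    · exact (Set.finite_range fun i : Fin n => (X i ^ a : MvPolynomial (Fin n) ℂ)).subset
        fun f ⟨i, hi⟩ => ⟨i, hi.symm⟩
    · exact (Set.finite_range fun S : Finset (Fin n) => skipDemazure r S).subset
        fun f ⟨S, _, _, hS⟩ => ⟨S, hS.symm⟩
  obtain ⟨A, V, hA, hV, hAV⟩ := exists_alphabet k hr he
  let good : (Fin n →₀ ℕ) → Prop := fun d => (∀ i, d i < a) ∧ IsStandard k r n k d
  have hsub : powerIdeal n k r a ≤ topFormIdeal (coverPoints n A V r) := by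
    refine Ideal.span_le.2 ?_
    rintro f (⟨i, rfl⟩ | ⟨d, hd, -, rfl⟩)
    · have := X_pow_mem_topFormIdeal A V r i
      rwa [hV] at this
    · exact esymmPow_mem_topFormIdeal A V hr (by omega)
  have hcov : ∀ c, ¬ good c →
      ∃ g ∈ powerBasis n k r a Q, MonomialOrder.lex.degree g ≤ c := by
    intro c hc
    by_cases hca : ∀ i, c i < a
    · have hns : ¬ IsStandard k r n k c := fun h => hc ⟨hca, h⟩
      obtain ⟨S, hS, hS'⟩ := exists_finset_of_not_isStandard k r n k le_rfl c hns
      have hle : ∀ i, r * skipComposition S i ≤ c i := by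
        intro i
        by_cases hi : i ∈ S
        · have := hS' i hi
          rw [skipComposition_of_mem hi, mul_comm]
          simpa using this
        · rw [skipComposition_of_notMem hi, mul_zero]
          exact Nat.zero_le _
      have hSc : S.card = n - k + 1 := by omega
      refine ⟨_, Or.inr ⟨S, hQ S hSc fun i => (hle i).trans_lt (hca i), hSc, rfl⟩, ?_⟩
      rw [degree_skipDemazure hr.ne']
      exact fun i => hle i
    · push Not at hca
      obtain ⟨i, hi⟩ := hca
      refine ⟨_, Or.inl ⟨i, rfl⟩, ?_⟩
      rw [degree_X_pow]
      exact Finsupp.single_le_iff.2 hi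
  refine isGroebnerBasis_of_forall_degree_le hfin hBI hlc fun f hf hf0 => ?_
  apply hcov
  refine not_standard_lex_degree (Y := coverPoints n A V r) ?_ ?_ (hsub hf) hf0
  · intro F hF hgood
    refine eq_zero_of_eval_eq_zero (r := r) A V ?_ n k F ?_ ?_
    · convert hAV
    · rw [hV, hA]; exact hgood
    · intro x hx hk
      refine hF x ⟨hx, ?_⟩
      have hsubset : hit A r x ⊆ A := Finset.filter_subset _ _
      have := Finset.eq_of_subset_of_card_le hsubset (by rw [hA]; exact hk)
      intro b hb
      rw [← this] at hb
      exact (Finset.mem_filter.1 hb).2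
  · intro c hc
    obtain ⟨g, hg, hgc⟩ := hcov c hc
    refine ⟨g, hsub (hBI g hg), fun h => ?_, hgc⟩
    have := hlc g hg
    rw [h, MonomialOrder.leadingCoeff_zero] at this
    exact zero_ne_one this

theorem isReducedGroebnerBasis_powerBasis {k r e : ℕ} (hk : 0 < k) (hkn : k < n) (hr : 0 < r)
    (he : e ≤ 1) {Q : Finset (Fin n) → Prop}
    (hQ : ∀ S : Finset (Fin n), S.card = n - k + 1 →
      ((∀ i, r * skipComposition S i < k * r + e) ↔ Q S)) :
    IsReducedGroebnerBasis MonomialOrder.lex (powerBasis n k r (k * r + e) Q)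
      (powerIdeal n k r (k * r + e)) := by
  refine ⟨isGroebnerBasis_powerBasis hkn.le hr he fun S hS => (hQ S hS).1,
    fun g hg => leadingCoeff_of_mem_powerBasis hr.ne' hg, ?_⟩
  have ha : 0 < k * r + e := Nat.add_pos_left (Nat.mul_pos hk hr) e
  set a := k * r + e
  rintro g (⟨i, rfl⟩ | ⟨S, hSQ, hS, rfl⟩) h (⟨j, rfl⟩ | ⟨T, hTQ, hT, rfl⟩) hne d hd hle
  · rw [X_pow_eq_monomial, mem_support_iff, coeff_monomial, ite_ne_right_iff] at hd
    rw [degree_X_pow, ← hd.1, Finsupp.single_le_iff, Finsupp.single_apply] at hle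
    split_ifs at hle with hji
    · exact hne (by rw [hji])
    · omega
  · rw [degree_X_pow, Finsupp.single_le_iff] at hle
    obtain ⟨c, hc, -, hmax⟩ := exists_of_mem_support_skipDemazure T hd
    obtain ⟨p, -, hp⟩ := hmax i
    have h1 := (hQ T hT).2 hTQ p
    have h2 := Nat.mul_le_mul_left r hp
    rw [hc] at hle
    omega
  · rw [X_pow_eq_monomial, mem_support_iff, coeff_monomial, ite_ne_right_iff] at hd
    rw [degree_skipDemazure hr.ne', ← hd.1] at hle
    -- As `k < n`, `S` has at least two elements, so its leading monomial involves a variable other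
    -- than `x_j`.
    obtain ⟨l, hl, hlj⟩ := Finset.exists_mem_ne (by omega : 1 < S.card) j
    have h1 : r * skipComposition S l ≤ Finsupp.single j a l := hle l
    rw [Finsupp.single_eq_of_ne hlj] at h1
    have := Nat.mul_pos hr (skipComposition_pos hl)
    omega
  · obtain ⟨c, hc, hsum, hmax⟩ := exists_of_mem_support_skipDemazure T hd
    rw [degree_skipDemazure hr.ne'] at hle
    refine not_skipComposition_le (hS.trans hT.symm) (fun h => hne (by rw [h])) hsum hmax
      fun i => ?_
    have h1 : r * skipComposition S i ≤ d i := hle i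
    rw [hc] at h1
    exact Nat.le_of_mul_le_mul_left h1 hr

theorem mul_skipComposition_lt {k r : ℕ} (hkn : k ≤ n) {S : Finset (Fin n)}
    (hS : S.card = n - k + 1) (i : Fin n) : r * skipComposition S i < k * r + 1 := by
  by_cases hi : i ∈ S
  · have := skipComposition_add_card_le hi fun j _ => j.isLt
    have := Nat.mul_le_mul_left r (show skipComposition S i ≤ k by omega)
    rw [mul_comm k]
    omega
  · rw [skipComposition_of_notMem hi]; omega

/-- If the last position lies in `S`, its part is at least `n - (n - k) = k`; otherwise all parts
are at most `k - 1`. -/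
theorem forall_mul_skipComposition_lt_iff {k r : ℕ} (hk : 0 < k) (hkn : k ≤ n) (hr : 0 < r)
    {S : Finset (Fin n)} (hS : S.card = n - k + 1) :
    (∀ i, r * skipComposition S i < k * r + 0) ↔ ∀ i ∈ S, (i : ℕ) + 1 ≤ n - 1 := by
  rw [add_zero, mul_comm k]
  constructor
  · intro h i hi
    by_contra hlt
    have h1 := Nat.lt_of_mul_lt_mul_left (h i)
    rw [skipComposition_of_mem hi] at h1
    have h2 : S.filter (· < i) ⊂ S := ⟨Finset.filter_subset _ _, fun h => by simpa using h hi⟩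
    have := Finset.card_lt_card h2
    have := i.isLt
    omega
  · intro h i
    refine Nat.mul_lt_mul_of_pos_left ?_ hr
    by_cases hi : i ∈ S
    · have := skipComposition_add_card_le hi fun j hj => h j hj
      have := i.isLt
      omega
    · rw [skipComposition_of_notMem hi]; exact hk

end Main

end SkipGroebner

end

theorem mainTheorem6 (n k r : ℕ) (hn : 1 ≤ n) (hkn : k ≤ n) (hr : 2 ≤ r) :
    (SkipGroebner.IsGroebnerBasis MonomialOrder.lex
        (SkipGroebner.basisI n k r) (SkipGroebner.idealI n k r) ∧
      (0 < k → k < n → SkipGroebner.IsReducedGroebnerBasis MonomialOrder.lex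
        (SkipGroebner.basisI n k r) (SkipGroebner.idealI n k r))) ∧
    (SkipGroebner.IsGroebnerBasis MonomialOrder.lex
        (SkipGroebner.basisJ n k r) (SkipGroebner.idealJ n k r) ∧
      (0 < k → k < n → SkipGroebner.IsReducedGroebnerBasis MonomialOrder.lex
        (SkipGroebner.basisJ n k r) (SkipGroebner.idealJ n k r))) := by
  have hr0 : 0 < r := by omega
  have hBI : SkipGroebner.basisI n k r
      = SkipGroebner.powerBasis n k r (k * r + 1) fun _ => True := by
    simp only [SkipGroebner.basisI, SkipGroebner.powerBasis, true_and]
  have hBJ : SkipGroebner.basisJ n k r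
      = SkipGroebner.powerBasis n k r (k * r + 0) fun S => ∀ i ∈ S, (i : ℕ) + 1 ≤ n - 1 := rfl
  have hII : SkipGroebner.idealI n k r = SkipGroebner.powerIdeal n k r (k * r + 1) := rfl
  have hIJ : SkipGroebner.idealJ n k r = SkipGroebner.powerIdeal n k r (k * r + 0) := rfl
  rw [hBI, hBJ, hII, hIJ]
  refine ⟨⟨SkipGroebner.isGroebnerBasis_powerBasis hkn hr0 le_rfl fun _ _ _ => trivial,
    fun hk hkn' => SkipGroebner.isReducedGroebnerBasis_powerBasis hk hkn' hr0 le_rfl fun S hS =>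
      iff_true_intro (SkipGroebner.mul_skipComposition_lt hkn hS)⟩,
    SkipGroebner.isGroebnerBasis_powerBasis hkn hr0 zero_le_one fun S hS hlt => ?_,
    fun hk hkn' => SkipGroebner.isReducedGroebnerBasis_powerBasis hk hkn' hr0 zero_le_one
      fun S hS => SkipGroebner.forall_mul_skipComposition_lt_iff hk hkn hr0 hS⟩
  -- For `k = 0` the bound `kr` is 0 and no part lies below it; `n ≥ 1` supplies a position to
  -- contradict.
  rcases Nat.eq_zero_or_pos k with rfl | hk
  · have := hlt ⟨0, hn⟩
    omega
  · exact (SkipGroebner.forall_mul_skipComposition_lt_iff hk hkn hr0 hS).1 hlt
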